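/- **Setting.** Let $(X,Y)$ be a random vector in $\mathbb{R}^p\times\mathbb{R}$ with law $\mathcal P$, let $P_{Y|x}$ be a regular conditional distribution of $Y$ given $X=x$, let $V:\mathbb{R}^p\times\mathbb{R}\to\mathbb{R}$ be a fixed measurable score function, and let $\alpha\in(0,1)$. Let $d:\mathbb{R}^p\times\mathbb{R}^p\to[0,\infty]$ be measurable with $d(x,x)=0$ for all $x$, let $h_n>0$ $(n\ge 1)$, and put $H(x,x')=\exp(-d(x,x')/h_n)$ (with $e^{-\infty}=0$). Let $Z_i=(X_i,Y_i)$, $i=1,\dots,n+1$, be i.i.d. with law $\mathcal P$, and $V_i=V(Z_i)$. Put $p_{ij}=H(X_i,X_j)/\sum_{k=1}^{n+1}H(X_i,X_k)$. For a distribution $\mathcal F$ on $[-\infty,\infty]$ let $Q(a;\mathcal F)=\inf\{t:\mathcal F([-\infty,t])\ge a\}$. For $v\in\mathbb{R}$ let $$\hat{\mathcal F}_i(v)=\sum_{j=1}^{n}p_{ij}\delta_{V_j}+p_{i,n+1}\delta_v,\qquad \hat{\mathcal F}=\sum_{j=1}^{n}p_{n+1,j}\delta_{V_j}+p_{n+1,n+1}\delta_{\infty}.$$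 Let $\Gamma=\{\sum_{k\in I}p_{ik}:1\le i\le n+1,\ I\subseteq\{1,\dots,n+1\}\}$, and let $\tilde\alpha(v)$ be the smallest $a\in\Gamma$ such that $$\frac1{n+1}\sum_{i=1}^{n+1}\mathbf 1\{V_i\le Q(a;\hat{\mathcal F}_i(v))\}\ge\alpha,$$ where $V_{n+1}$ is replaced by $v$. Let $C_V(X_{n+1})=\{v\in\mathbb{R}: v\le Q(\tilde\alpha(v);\hat{\mathcal F})\}$. **Assumptions.** There are constants $L>0$ and $\beta\ge0$ such that: - $X$ takes values in $[0,1]^p$ and has a density $p_X$ there with $p_X(x)\ge 1/L$ for all $x\in[0,1]^p$; for every $x\in[0,1]^p$ the distribution of $V(x,Y)$, $Y\sim P_{Y|x}$, is continuous, with distribution function $P_{V|x}$; - (i) $\sup_{v\in\mathbb{R}}|P_{V|x}(v)-P_{V|x'}(v)|\le L\,d(x,x')$ for all $x,x'\in[0,1]^p$; - (ii) $\mathbb{P}(d(x_0,X)\le\varepsilon)\ge\varepsilon^\beta/L$ for all $n\ge1$, all $0<\varepsilon\le h_n$ and all $x_0\in[0,1]^p$; - (iii) $h_n\to0$ and $nh_n^\beta/\ln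 n\to\infty$ as $n\to\infty$. **Theorem.** For every $x_0\in[0,1]^p$, where conditionally on $X_{n+1}=x_0$ the samples $Z_1,\dots,Z_n$ are i.i.d. with law $\mathcal P$ and independent of $Y_{n+1}\sim P_{Y|x_0}$, $$\lim_{n\to\infty}\mathbb{P}\big(V_{n+1}\in C_V(X_{n+1})\mid X_{n+1}=x_0\big)=\alpha,$$ $$\lim_{n\to\infty}\mathbb{P}\big(V_{n+1}\le Q(\alpha;\hat{\mathcal F})\mid X_{n+1}=x_0\big)=\alpha,$$ $$\lim_{n\to\infty}\mathbb{P}\Big(\sup_{v\in\mathbb{R}}|\tilde\alpha(v)-\alpha|<\varepsilon\;\Big|\;X_{n+1}=x_0\Big)=1\quad\text{for all }\varepsilon>0.$$ -/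

import Mathlib

open MeasureTheory ProbabilityTheory Filter Topology
open scoped ENNReal

namespace LCP

noncomputable section

/-- Level-`a` quantile `inf {t : F((-∞, t]) ≥ a}` of a distribution `F` on the extended reals
(so that `F` may charge `+∞`, and the level-`0` quantile is `-∞`). -/
def quantile (a : ℝ) (F : Measure EReal) : EReal :=
  sInf {t : EReal | a ≤ F.real (Set.Iic t)}

/-- The localizer `H(x, x') = exp(-d(x, x') / h)`, with `exp(-∞) = 0`. -/
def localizer {E : Type*} (d : E → E → ℝ≥0∞) (h : ℝ) (x x' : E) : ℝ :=
  if d x x' = ⊤ then 0 else Real.exp (-(d x x').toReal / h)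

variable {E : Type*} {n : ℕ}

/-- The empirical weights `p^H_{i,j} = H(X_i, X_j) / ∑_k H(X_i, X_k)`. -/
def weight (H : E → E → ℝ) (X : Fin (n + 1) → E) (i j : Fin (n + 1)) : ℝ :=
  H (X i) (X j) / ∑ k, H (X i) (X k)

/-- The weighted distribution `∑_j p^H_{i,j} δ_{u_j}`. -/
def weightedLaw (H : E → E → ℝ) (X : Fin (n + 1) → E) (i : Fin (n + 1))
    (u : Fin (n + 1) → EReal) : Measure EReal :=
  ∑ j, ENNReal.ofReal (weight H X i j) • Measure.dirac (u j)

/-- `F̂_i(v)`: the weighted distribution centered at `X_i` when the last score is set to `v`. -/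
def empLaw (H : E → E → ℝ) (X : Fin (n + 1) → E) (S : Fin (n + 1) → ℝ) (v : ℝ)
    (i : Fin (n + 1)) : Measure EReal :=
  weightedLaw H X i (fun j => ((Function.update S (Fin.last n) v j : ℝ) : EReal))

/-- `F̂`: the weighted distribution centered at the last point, with the last score set to `+∞`. -/
def testLaw (H : E → E → ℝ) (X : Fin (n + 1) → E) (S : Fin (n + 1) → ℝ) : Measure EReal :=
  weightedLaw H X (Fin.last n) (Function.update (fun j => (S j : EReal)) (Fin.last n) ⊤)

/-- `Γ`: the (finite) set of all partial sums of weights `∑_{k ∈ I} p^H_{i,k}`. -/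
def levels (H : E → E → ℝ) (X : Fin (n + 1) → E) : Set ℝ :=
  {a | ∃ (i : Fin (n + 1)) (I : Finset (Fin (n + 1))), a = ∑ k ∈ I, weight H X i k}

/-- `(n+1)⁻¹ ∑_i 1{V_i ≤ Q(a; F̂_i(v))}`, where the last score is set to `v`. -/
def coverFraction (H : E → E → ℝ) (X : Fin (n + 1) → E) (S : Fin (n + 1) → ℝ) (v a : ℝ) : ℝ :=
  ∑ i, 1 / ((n : ℝ) + 1) *
    (if ((Function.update S (Fin.last n) v i : ℝ) : EReal) ≤ quantile a (empLaw H X S v i)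
      then 1 else 0)

/-- `α̃(v)`: the smallest `a ∈ Γ` with `(n+1)⁻¹ ∑_i 1{V_i ≤ Q(a; F̂_i(v))} ≥ α`. -/
def alphaTilde (H : E → E → ℝ) (X : Fin (n + 1) → E) (S : Fin (n + 1) → ℝ) (α v : ℝ) : ℝ :=
  sInf {a | a ∈ levels H X ∧ α ≤ coverFraction H X S v a}

/-- `C_V(X_{n+1}) = {v : v ≤ Q(α̃(v); F̂)}`. -/
def predSet (H : E → E → ℝ) (X : Fin (n + 1) → E) (S : Fin (n + 1) → ℝ) (α : ℝ) : Set ℝ :=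
  {v | (v : EReal) ≤ quantile (alphaTilde H X S α v) (testLaw H X S)}

/-- The law of i.i.d. data `Z_1, …, Z_{n+1} ~ P` conditionally on `X_{n+1} = x₀`, where `κ` is the
conditional distribution of `Y` given `X`: the samples stay independent, `Z_1, …, Z_n` keep the
law `P`, and `Z_{n+1} = (x₀, Y)` with `Y ~ κ x₀`. -/
def condLaw [MeasurableSpace E] (P : Measure (E × ℝ)) (κ : Kernel E ℝ) (n : ℕ) (x₀ : E) :
    Measure (Fin (n + 1) → E × ℝ) :=
  Measure.pi (fun i => if i = Fin.last n then (Measure.dirac x₀).prod (κ x₀) else P)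

/-- `P_{V|x}(v)`: the probability that `V(x, Y) ≤ v` when `Y ~ κ x`. -/
def condCDF [MeasurableSpace E] (κ : Kernel E ℝ) (V : E × ℝ → ℝ) (x : E) (v : ℝ) : ℝ :=
  (κ x).real {y | V (x, y) ≤ v}

end

end LCP

/-! Write `F_i` for the conditional distribution function of the score given `X_i`. Given the
covariates, the scores are independent, and the weighted distribution in row `i` is uniformly close
to `F_i`. If every row sum of the localizer is at least `T`, no weight exceeds `1 / T`, so
Hoeffding's inequality gives fluctuations with tail `exp (-c T)`. The bias is small because points
farther than `r` carry exponentially small weight, while nearer points have conditional distribution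
functions within `L r`. A Chernoff bound allows `T` of order `n * h_n ^ β`, and since `T / log n →
∞`, union bounds over the `n + 1` rows cost nothing in the limit.

On this event, `V_i ≤ Q(a; F̂_i(v))` means `F_i(V_i) ≤ a` up to a multiple of the tolerance `η`. By
the probability integral transform the `F_i(V_i)` behave like independent uniform variables, so the
cover fraction at level `a` is about `a`, and `α̃(v)` is within `7η` of `α`. This is uniform in `v`,
because `v` affects one atom of small weight and one term of the average. The coverage events are
then squeezed between `F_{n+1}(V_{n+1}) ≤ α - 10η` and `F_{n+1}(V_{n+1}) < α + 10η`.

The deterministic half is `RegularSample`. Its probability is bounded in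
`pi_real_not_regularData_le` and sent to its limit in `tendsto_real_not_regularData`;
`tendsto_real_of_regularData` is the squeeze. -/

namespace LCP

/-! ### Quantiles of laws close to a given distribution function. -/

section Quantile

lemma le_quantile_iff {a : ℝ} {F : Measure EReal} {v : EReal} :
    v ≤ quantile a F ↔ ∀ t, a ≤ F.real (Set.Iic t) → v ≤ t :=
  le_sInf_iff

lemma le_quantile_of_add_lt {F : Measure EReal} [IsFiniteMeasure F] {G : ℝ → ℝ} (hG : Monotone G)
    {ε a v : ℝ} (hF : ∀ t : ℝ, |F.real (Set.Iic (t : EReal)) - G t| ≤ ε) (h : G v + ε < a) :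
    (v : EReal) ≤ quantile a F := by
  rw [le_quantile_iff]
  intro t ht
  by_contra! htv
  -- The closeness bound is available only at real points, whereas `t` may be `-∞`.
  obtain ⟨s, hts, hsv⟩ := EReal.lt_iff_exists_real_btwn.1 htv
  have h1 : F.real (Set.Iic t) ≤ F.real (Set.Iic (s : EReal)) :=
    measureReal_mono (Set.Iic_subset_Iic.2 hts.le)
  have h2 := (abs_le.1 (hF s)).2
  have h3 := hG (EReal.coe_lt_coe_iff.1 hsv).le
  linarith

/-- Lying below the quantile controls `F` only at points strictly left of `v`; continuity of `G`
carries the bound to `v` itself. -/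
lemma le_add_of_le_quantile {F : Measure EReal} {G : ℝ → ℝ} (hG : Continuous G)
    {ε a v : ℝ} (hF : ∀ t : ℝ, |F.real (Set.Iic (t : EReal)) - G t| ≤ ε)
    (h : (v : EReal) ≤ quantile a F) : G v ≤ a + ε := by
  rw [le_quantile_iff] at h
  refine le_of_tendsto (hG.continuousWithinAt (s := Set.Iio v) (x := v)) ?_
  filter_upwards [self_mem_nhdsWithin] with s hs
  have h1 : F.real (Set.Iic (s : EReal)) < a := by
    by_contra! hc
    exact absurd (EReal.coe_le_coe_iff.1 (h s hc)) (not_le.2 hs)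
  have h2 := (abs_le.1 (hF s)).1
  linarith

end Quantile

/-! ### Weighted empirical laws and partial sums of weights. -/

section WeightedSums

variable {E : Type*} {n : ℕ}

lemma weight_nonneg {H : E → E → ℝ} (hH : ∀ x y, 0 ≤ H x y) (X : Fin (n + 1) → E)
    (i j : Fin (n + 1)) : 0 ≤ weight H X i j :=
  div_nonneg (hH _ _) (Finset.sum_nonneg fun _ _ => hH _ _)

lemma sum_weight {H : E → E → ℝ} {X : Fin (n + 1) → E} {i : Fin (n + 1)}
    (hpos : 0 < ∑ k, H (X i) (X k)) : ∑ j, weight H X i j = 1 := by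
  simp only [weight]
  exact (Finset.sum_div _ _ _).symm.trans (div_self (ne_of_gt hpos))

/-- The distribution function of `∑_j p^H_{i,j} δ_{S_j}`. -/
noncomputable def weightedCDF (H : E → E → ℝ) (X : Fin (n + 1) → E) (i : Fin (n + 1))
    (S : Fin (n + 1) → ℝ) (t : ℝ) : ℝ :=
  ∑ j, weight H X i j * (if S j ≤ t then 1 else 0)

instance isFiniteMeasure_weightedLaw (H : E → E → ℝ) (X : Fin (n + 1) → E) (i : Fin (n + 1))
    (u : Fin (n + 1) → EReal) : IsFiniteMeasure (weightedLaw H X i u) := by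
  refine ⟨?_⟩
  simp [weightedLaw, Measure.finsetSum_apply]

lemma weightedLaw_real_Iic {H : E → E → ℝ} (hH : ∀ x y, 0 ≤ H x y) (X : Fin (n + 1) → E)
    (i : Fin (n + 1)) (u : Fin (n + 1) → EReal) (t : EReal) :
    (weightedLaw H X i u).real (Set.Iic t) =
      ∑ j, weight H X i j * (if u j ≤ t then 1 else 0) := by
  rw [measureReal_def, weightedLaw, Measure.finsetSum_apply, ENNReal.toReal_sum]
  · refine Finset.sum_congr rfl fun j _ => ?_
    by_cases h : u j ≤ t <;>
      simp [h, ENNReal.toReal_ofReal (weight_nonneg hH X i j),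
        Measure.dirac_apply' _ measurableSet_Iic]
  · intro j _
    by_cases h : u j ≤ t <;> simp [h, Measure.dirac_apply' _ measurableSet_Iic]

/-- Only the last atom can differ, so one estimate serves both `empLaw` (atom moved to `v`) and
`testLaw` (atom moved to `+∞`). -/
lemma abs_weightedLaw_sub_weightedCDF_le {H : E → E → ℝ} (hH : ∀ x y, 0 ≤ H x y)
    (X : Fin (n + 1) → E) (i : Fin (n + 1)) {u : Fin (n + 1) → EReal} {S : Fin (n + 1) → ℝ}
    (hu : ∀ j, j ≠ Fin.last n → u j = (S j : EReal)) (t : ℝ) :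
    |(weightedLaw H X i u).real (Set.Iic (t : EReal)) - weightedCDF H X i S t| ≤
      weight H X i (Fin.last n) := by
  rw [weightedLaw_real_Iic hH, weightedCDF, ← Finset.sum_sub_distrib,
    Finset.sum_eq_single (Fin.last n)]
  · have := weight_nonneg hH X i (Fin.last n)
    split_ifs <;> simp [abs_of_nonneg, this]
  · intro j _ hj
    simp [hu j hj]
  · simp

/-- Terms are added one at a time: the first partial sum to reach `c` overshoots by at most one
weight. Hence the discrete set `levels` comes within `η` above any attainable level. -/
lemma exists_subset_sum_mem_Icc {ι : Type*} [DecidableEq ι] {w : ι → ℝ} {η c : ℝ}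
    (s : Finset ι) (hw : ∀ i ∈ s, w i ≤ η) (hc : 0 ≤ c) (hη : 0 ≤ η) (hs : c ≤ ∑ i ∈ s, w i) :
    ∃ I : Finset ι, c ≤ ∑ i ∈ I, w i ∧ ∑ i ∈ I, w i ≤ c + η := by
  induction s using Finset.induction_on with
  | empty => exact ⟨∅, hs, by simp; positivity⟩
  | insert a s ha ih =>
    by_cases h : c ≤ ∑ i ∈ s, w i
    · exact ih (fun i hi => hw i (Finset.mem_insert_of_mem hi)) h
    · refine ⟨insert a s, hs, ?_⟩
      rw [Finset.sum_insert ha]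
      have := hw a (Finset.mem_insert_self a s)
      linarith [not_le.1 h]

/-- Replacing the last score by `v` alters the last summand in an uncontrolled way, at a cost of at
most `1 / (n + 1)`. -/
lemma sum_inv_mul_le_add {f g : Fin (n + 1) → ℝ} (hf : f (Fin.last n) ≤ 1)
    (hg : 0 ≤ g (Fin.last n)) (hfg : ∀ i, i ≠ Fin.last n → f i ≤ g i) :
    ∑ i, 1 / ((n : ℝ) + 1) * f i ≤ ∑ i, 1 / ((n : ℝ) + 1) * g i + 1 / ((n : ℝ) + 1) := by
  have hn : 0 ≤ 1 / ((n : ℝ) + 1) := by positivity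
  rw [Fin.sum_univ_castSucc, Fin.sum_univ_castSucc (f := fun i => 1 / ((n : ℝ) + 1) * g i)]
  have h1 : ∑ i : Fin n, 1 / ((n : ℝ) + 1) * f i.castSucc ≤
      ∑ i : Fin n, 1 / ((n : ℝ) + 1) * g i.castSucc :=
    Finset.sum_le_sum fun i _ => mul_le_mul_of_nonneg_left (hfg _ (Fin.castSucc_ne_last i)) hn
  have h2 := mul_le_mul_of_nonneg_left hf hn
  have h3 := mul_nonneg hn hg
  linarith

end WeightedSums

/-! ### Deterministic consequences of regularity of a sample. -/

section GoodSample

variable {E : Type*} {n : ℕ}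

/-- A sample is regular with tolerance `η` when the weights are at most `η`, the weighted
distribution functions are `η`-close to the distribution functions `F i`, and the transformed
scores `F i (S i)` have empirical frequencies close to those of uniform variables
near level `α`. -/
structure RegularSample (H : E → E → ℝ) (X : Fin (n + 1) → E) (S : Fin (n + 1) → ℝ)
    (F : Fin (n + 1) → ℝ → ℝ) (α η : ℝ) : Prop where
  nonneg : ∀ x y, 0 ≤ H x y
  row_pos : ∀ i, 0 < ∑ k, H (X i) (X k)
  weight_le : ∀ i j, weight H X i j ≤ η
  mono : ∀ i, Monotone (F i)
  cont : ∀ i, Continuous (F i)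
  close : ∀ i t, |weightedCDF H X i S t - F i t| ≤ η
  inv_le : 1 / ((n : ℝ) + 1) ≤ η
  -- A uniform variable lies below `α - 3η` with probability `α - 3η`; one further `η` is left for
  -- sampling fluctuations, and symmetrically in the next field.
  freq_le : ∑ i, 1 / ((n : ℝ) + 1) * (if F i (S i) < α - 3 * η then 1 else 0) ≤ α - 2 * η
  le_freq : α + 2 * η ≤ ∑ i, 1 / ((n : ℝ) + 1) * (if F i (S i) ≤ α + 3 * η then 1 else 0)

namespace RegularSample

variable {H : E → E → ℝ} {X : Fin (n + 1) → E} {S : Fin (n + 1) → ℝ}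
  {F : Fin (n + 1) → ℝ → ℝ} {α η : ℝ}

lemma pos (h : RegularSample H X S F α η) : 0 < η :=
  lt_of_lt_of_le (by positivity) h.inv_le

lemma abs_weightedLaw_sub_le (h : RegularSample H X S F α η) (i : Fin (n + 1))
    {u : Fin (n + 1) → EReal} (hu : ∀ j, j ≠ Fin.last n → u j = (S j : EReal)) (t : ℝ) :
    |(weightedLaw H X i u).real (Set.Iic (t : EReal)) - F i t| ≤ 2 * η := by
  have h1 := abs_weightedLaw_sub_weightedCDF_le h.nonneg X i hu t
  have h2 := h.close i t
  have h3 := h.weight_le i (Fin.last n)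
  rw [abs_le] at *
  constructor <;> linarith

lemma abs_empLaw_sub_le (h : RegularSample H X S F α η) (v : ℝ) (i : Fin (n + 1)) (t : ℝ) :
    |(empLaw H X S v i).real (Set.Iic (t : EReal)) - F i t| ≤ 2 * η :=
  h.abs_weightedLaw_sub_le i (fun j hj => by simp [Function.update_of_ne hj]) t

lemma abs_testLaw_sub_le (h : RegularSample H X S F α η) (t : ℝ) :
    |(testLaw H X S).real (Set.Iic (t : EReal)) - F (Fin.last n) t| ≤ 2 * η :=
  h.abs_weightedLaw_sub_le _ (fun j hj => by simp [Function.update_of_ne hj]) t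

/-- A covered index other than the last has `F i (S i) ≤ a + 2η ≤ α - 4η`, hence is counted in
`freq_le`. The last index adds at most `η` to the frequency `α - 2η`. -/
lemma coverFraction_lt (h : RegularSample H X S F α η) (v : ℝ) {a : ℝ} (ha : a ≤ α - 6 * η) :
    coverFraction H X S v a < α := by
  have hη := h.pos
  refine lt_of_le_of_lt (sum_inv_mul_le_add
    (g := fun i => if F i (S i) < α - 3 * η then 1 else 0) ?_ ?_ ?_) ?_
  · split_ifs <;> norm_num
  · split_ifs <;> norm_num
  · intro i hi
    rw [Function.update_of_ne hi]
    by_cases hc : ((S i : ℝ) : EReal) ≤ quantile a (empLaw H X S v i)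
    · have := le_add_of_le_quantile (h.cont i) (h.abs_empLaw_sub_le v i) hc
      rw [if_pos hc, if_pos (by linarith)]
    · rw [if_neg hc]
      split_ifs <;> norm_num
  · linarith [h.freq_le, h.inv_le]

lemma le_coverFraction (h : RegularSample H X S F α η) (v : ℝ) {a : ℝ} (ha : α + 6 * η ≤ a) :
    α ≤ coverFraction H X S v a := by
  have hη := h.pos
  have key := sum_inv_mul_le_add (n := n)
    (f := fun i => if F i (S i) ≤ α + 3 * η then 1 else 0)
    (g := fun i => if ((Function.update S (Fin.last n) v i : ℝ) : EReal) ≤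
      quantile a (empLaw H X S v i) then 1 else 0) ?_ ?_ ?_
  · rw [coverFraction]
    linarith [h.le_freq, h.inv_le]
  · split_ifs <;> norm_num
  · split_ifs <;> norm_num
  · intro i hi
    rw [Function.update_of_ne hi]
    by_cases hc : F i (S i) ≤ α + 3 * η
    · have : IsFiniteMeasure (empLaw H X S v i) := isFiniteMeasure_weightedLaw ..
      have := le_quantile_of_add_lt (h.mono i) (h.abs_empLaw_sub_le v i) (a := a) (v := S i)
        (by linarith)
      rw [if_pos hc, if_pos this]
    · rw [if_neg hc]
      split_ifs <;> norm_num

lemma abs_alphaTilde_sub_le (h : RegularSample H X S F α η) (hα : 0 ≤ α) (hα' : α + 6 * η ≤ 1)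
    (v : ℝ) : |alphaTilde H X S α v - α| ≤ 7 * η := by
  have hη := h.pos
  -- The last row supplies an element of `levels` between `α + 6η` and `α + 7η`, a feasible level
  -- that bounds the infimum from above.
  obtain ⟨I, hI1, hI2⟩ := exists_subset_sum_mem_Icc (w := weight H X (Fin.last n)) Finset.univ
    (fun i _ => h.weight_le _ i) (c := α + 6 * η) (by positivity) hη.le
    (by rw [sum_weight (h.row_pos _)]; exact hα')
  have hlb : ∀ a ∈ {a | a ∈ levels H X ∧ α ≤ coverFraction H X S v a}, α - 6 * η ≤ a := by
    rintro a ⟨-, ha⟩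
    by_contra! hc
    exact absurd (h.coverFraction_lt v hc.le) (not_lt.2 ha)
  have hmem : ∑ i ∈ I, weight H X (Fin.last n) i ∈
      {a | a ∈ levels H X ∧ α ≤ coverFraction H X S v a} :=
    ⟨⟨_, I, rfl⟩, h.le_coverFraction v hI1⟩
  have h1 : alphaTilde H X S α v ≤ _ := csInf_le ⟨_, hlb⟩ hmem
  have h2 : α - 6 * η ≤ alphaTilde H X S α v := le_csInf ⟨_, hmem⟩ hlb
  rw [abs_le]
  constructor <;> linarith

lemma le_quantile_testLaw (h : RegularSample H X S F α η) {a v : ℝ} (ha : α - 7 * η ≤ a)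
    (hv : F (Fin.last n) v ≤ α - 10 * η) : (v : EReal) ≤ quantile a (testLaw H X S) := by
  have : IsFiniteMeasure (testLaw H X S) := isFiniteMeasure_weightedLaw ..
  exact le_quantile_of_add_lt (h.mono _) h.abs_testLaw_sub_le (by linarith [h.pos])

lemma lt_of_le_quantile_testLaw (h : RegularSample H X S F α η) {a v : ℝ} (ha : a ≤ α + 7 * η)
    (hv : (v : EReal) ≤ quantile a (testLaw H X S)) : F (Fin.last n) v < α + 10 * η := by
  have := le_add_of_le_quantile (h.cont _) h.abs_testLaw_sub_le hv
  linarith [h.pos]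

end RegularSample

end GoodSample

/-! ### Continuity of distribution functions and the probability integral transform. -/

section Distribution

variable {Ω : Type*} [MeasurableSpace Ω] {ν : Measure Ω} [IsProbabilityMeasure ν] {W : Ω → ℝ}

lemma cdf_map_eq (hW : Measurable W) (t : ℝ) : cdf (ν.map W) t = ν.real {ω | W ω ≤ t} := by
  have := Measure.isProbabilityMeasure_map (μ := ν) hW.aemeasurable
  rw [cdf_eq_real, map_measureReal_apply hW measurableSet_Iic]
  rfl

lemma continuous_real_setOf_le (hW : Measurable W) (h0 : ∀ v, ν {ω | W ω = v} = 0) :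
    Continuous fun t => ν.real {ω | W ω ≤ t} := by
  have := Measure.isProbabilityMeasure_map (μ := ν) hW.aemeasurable
  simp_rw [← cdf_map_eq hW]
  rw [continuous_iff_continuousAt]
  intro t
  have hmono := monotone_cdf (ν.map W)
  rw [hmono.continuousAt_iff_leftLim_eq_rightLim, StieltjesFunction.rightLim_eq]
  have h1 : (cdf (ν.map W)).measure {t} = 0 := by
    rw [measure_cdf, Measure.map_apply hW (measurableSet_singleton t)]
    exact h0 t
  rw [StieltjesFunction.measure_singleton, ENNReal.ofReal_eq_zero] at h1
  exact le_antisymm (hmono.leftLim_le le_rfl) (by linarith)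

lemma exists_real_setOf_le_eq (hW : Measurable W) (h0 : ∀ v, ν {ω | W ω = v} = 0) {s : ℝ}
    (hs : s ∈ Set.Ioo (0 : ℝ) 1) : ∃ t, ν.real {ω | W ω ≤ t} = s := by
  have hb := tendsto_cdf_atBot (ν.map W)
  have ht := tendsto_cdf_atTop (ν.map W)
  rw [funext (cdf_map_eq hW)] at hb ht
  exact mem_range_of_exists_le_of_exists_ge (continuous_real_setOf_le hW h0)
    (hb.eventually_le_const hs.1).exists (ht.eventually_const_le hs.2).exists

lemma monotone_real_setOf_le : Monotone fun t => ν.real {ω | W ω ≤ t} :=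
  fun _ _ hst => measureReal_mono fun _ hω => le_trans hω hst

/-- One half of the probability integral transform. -/
lemma real_transform_lt_le (hW : Measurable W) (h0 : ∀ v, ν {ω | W ω = v} = 0) {s : ℝ}
    (hs : s ∈ Set.Ioo (0 : ℝ) 1) :
    ν.real {ω | ν.real {ω' | W ω' ≤ W ω} < s} ≤ s := by
  obtain ⟨t, ht⟩ := exists_real_setOf_le_eq hW h0 hs
  refine (measureReal_mono (fun ω hω => ?_)).trans ht.le
  by_contra! hc
  have := monotone_real_setOf_le (ν := ν) (W := W) (not_le.1 hc).le
  simp only [Set.mem_ofPred_eq] at hω this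
  linarith

/-- The other half of the probability integral transform. -/
lemma le_real_transform_le (hW : Measurable W) (h0 : ∀ v, ν {ω | W ω = v} = 0) {s : ℝ}
    (hs : s ∈ Set.Ioo (0 : ℝ) 1) :
    s ≤ ν.real {ω | ν.real {ω' | W ω' ≤ W ω} ≤ s} := by
  obtain ⟨t, ht⟩ := exists_real_setOf_le_eq hW h0 hs
  refine ht.ge.trans (measureReal_mono fun ω hω => ?_)
  exact (monotone_real_setOf_le (ν := ν) (W := W) hω).trans ht.le

end Distribution

/-! ### From finitely or countably many points to uniform closeness. -/

section Grid

/-- A monotone function that is close to a continuous distribution function at the points of a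
grid of quantile levels is uniformly close to it. -/
lemma abs_sub_le_of_grid {G F : ℝ → ℝ} (hG : Monotone G) (hF : Monotone F)
    (hG0 : ∀ t, 0 ≤ G t) (hG1 : ∀ t, G t ≤ 1) (hF0 : ∀ t, 0 ≤ F t) (hF1 : ∀ t, F t ≤ 1)
    {K : ℕ} (hK : 0 < K) {τ : ℕ → ℝ} (hτ : ∀ k, 0 < k → k < K → F (τ k) = k / K) {ε : ℝ}
    (hε : 0 ≤ ε) (hclose : ∀ k, 0 < k → k < K → |G (τ k) - F (τ k)| ≤ ε) (t : ℝ) :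
    |G t - F t| ≤ ε + 2 / K := by
  have hK' : (0 : ℝ) < K := by exact_mod_cast hK
  set k := ⌊K * F t⌋₊ with hk
  have hk1 : (k : ℝ) ≤ K * F t := Nat.floor_le (mul_nonneg hK'.le (hF0 t))
  have hk2 : K * F t < k + 1 := Nat.lt_floor_add_one _
  have hk1' : (k : ℝ) / K ≤ F t := by rw [div_le_iff₀ hK']; linarith
  have hk2' : F t < (k + 1) / K := by rw [lt_div_iff₀ hK']; linarith
  have hdiv : (0 : ℝ) < 1 / K := by positivity
  have hd2 : (2 : ℝ) / K = 1 / K + 1 / K := by ring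
  have hd1 : ((k : ℝ) + 1) / K = k / K + 1 / K := by ring
  rw [abs_le]
  constructor
  -- The comparison point is `τ (k - 1)` rather than `τ k`: if `F` is flat, `F (τ k) ≤ F t` does not
  -- give `τ k ≤ t`, but the strict inequality at `k - 1` does. This costs the second `1 / K`.
  · rcases Nat.lt_or_ge k 2 with h2 | h2
    · have : (k : ℝ) ≤ 1 := by exact_mod_cast Nat.lt_succ_iff.1 h2
      have : (k : ℝ) / K ≤ 1 / K := by gcongr
      linarith [hG0 t]
    · have hkK : k ≤ K := by
        have : (k : ℝ) ≤ K := hk1.trans (by nlinarith [hF1 t])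
        exact_mod_cast this
      have e1 := hτ (k - 1) (by omega) (by omega)
      have e2 := (abs_le.1 (hclose (k - 1) (by omega) (by omega))).1
      rw [Nat.cast_sub (by omega), Nat.cast_one, sub_div] at e1
      have : τ (k - 1) ≤ t := by
        by_contra! hc
        have := hF hc.le
        linarith
      have := hG this
      linarith
  · rcases Nat.lt_or_ge (k + 1) K with h2 | h2
    · have e1 := hτ (k + 1) (by omega) h2
      have e2 := (abs_le.1 (hclose (k + 1) (by omega) h2)).2
      push_cast at e1
      have : t ≤ τ (k + 1) := by
        by_contra! hc
        have := hF hc.le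
        linarith
      have := hG this
      linarith
    · have : (1 : ℝ) ≤ (k + 1) / K := by
        rw [le_div_iff₀ hK']
        have : (K : ℝ) ≤ ((k + 1 : ℕ) : ℝ) := by exact_mod_cast h2
        push_cast at this
        linarith
      linarith [hG1 t]

/-- Rationals approach `t` from the left for the lower bound and from the right for the upper one,
matching the monotonicity of `G`. This lets the bad event be a countable union, hence measurable. -/
lemma abs_sub_le_of_forall_rat {G F : ℝ → ℝ} (hG : Monotone G) (hF : Continuous F) {ε : ℝ}
    (h : ∀ q : ℚ, |G q - F q| ≤ ε) (t : ℝ) : |G t - F t| ≤ ε := by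
  rw [abs_le]
  constructor
  · have : F t ≤ G t + ε := by
      by_contra! hc
      have := (hF.tendsto t).eventually (lt_mem_nhds hc)
      obtain ⟨l, hl, hlt⟩ := exists_Ioc_subset_of_mem_nhds this (exists_lt t)
      obtain ⟨q, hq1, hq2⟩ := exists_rat_btwn hl
      have h1 : G t + ε < F q := hlt ⟨hq1, hq2.le⟩
      have h2 := hG hq2.le
      have h3 := (abs_le.1 (h q)).1
      linarith
    linarith
  · have : G t ≤ F t + ε := by
      by_contra! hc
      have := (hF.tendsto t).eventually (gt_mem_nhds (show F t < G t - ε by linarith))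
      obtain ⟨u, hu, hut⟩ := exists_Ico_subset_of_mem_nhds this (exists_gt t)
      obtain ⟨q, hq1, hq2⟩ := exists_rat_btwn hu
      have h1 : F q < G t - ε := hut ⟨hq1.le, hq2⟩
      have h2 := hG hq1.le
      have h3 := (abs_le.1 (h q)).2
      linarith
    linarith

end Grid

/-! ### Hoeffding bounds for weighted sums. -/

section Concentration

/-- Hoeffding's inequality for weighted sums of independent `[0,1]`-valued variables. -/
lemma real_weighted_sum_ge_le {ι : Type*} [Fintype ι] {Ω : ι → Type*}
    [∀ i, MeasurableSpace (Ω i)] (ν : (i : ι) → Measure (Ω i)) [∀ i, IsProbabilityMeasure (ν i)]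
    {f : (i : ι) → Ω i → ℝ} (hf : ∀ i, Measurable (f i)) (hf01 : ∀ i ω, f i ω ∈ Set.Icc (0 : ℝ) 1)
    {w : ι → ℝ} (hw : ∀ i, 0 ≤ w i) (hw1 : ∑ i, w i = 1) {T : ℝ} (hT : 0 < T)
    (hwT : ∀ i, w i ≤ 1 / T) {ε : ℝ} (hε : 0 ≤ ε) :
    (Measure.pi ν).real {y | ε ≤ ∑ i, w i * (f i (y i) - ∫ ω, f i ω ∂ν i)} ≤
      Real.exp (-(2 * ε ^ 2 * T)) := by
  have hind : iIndepFun (fun i (y : (i : ι) → Ω i) => w i * (f i (y i) - ∫ ω, f i ω ∂ν i))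
      (Measure.pi ν) :=
    iIndepFun_pi (X := fun i ω => w i * (f i ω - ∫ ω, f i ω ∂ν i))
      fun i => (((hf i).sub_const _).const_mul _).aemeasurable
  have hsub : ∀ i ∈ Finset.univ, HasSubgaussianMGF
      (fun y : (i : ι) → Ω i => w i * (f i (y i) - ∫ ω, f i ω ∂ν i))
      (Real.toNNReal (w i ^ 2 / 4)) (Measure.pi ν) := by
    intro i _
    have hmean : ∫ ω, f i ω ∂ν i = ∫ y, f i (y i) ∂(Measure.pi ν) := by
      have := integral_map (μ := Measure.pi ν) (φ := Function.eval i)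
        (measurable_pi_apply i).aemeasurable (f := f i) (hf i).aestronglyMeasurable
      rwa [(measurePreserving_eval ν i).map_eq] at this
    rw [hmean]
    convert (hasSubgaussianMGF_of_mem_Icc (X := fun y : (i : ι) → Ω i => f i (y i))
      ((hf i).comp (measurable_pi_apply i)).aemeasurable
      (ae_of_all _ fun y => hf01 i (y i))).const_mul (w i) using 1
    refine NNReal.eq ?_
    rw [Real.coe_toNNReal _ (by positivity)]
    change _ = w i ^ 2 * (‖(1 : ℝ) - 0‖ / 2) ^ 2
    norm_num
    ring
    infer_instance
  refine (HasSubgaussianMGF.measure_sum_ge_le_of_iIndepFun hind hsub hε).trans ?_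
  have hc : ∀ i, (Real.toNNReal (w i ^ 2 / 4) : ℝ) = w i ^ 2 * (1 / 4) := fun i => by
    rw [Real.coe_toNNReal _ (by positivity)]
    ring
  rw [Real.exp_le_exp, NNReal.coe_sum, Finset.sum_congr rfl fun i _ => hc i, ← Finset.sum_mul]
  -- The sum of squares is at most the largest weight times the total mass, so `T` acts as an
  -- effective sample size.
  have h1 : ∑ i, w i ^ 2 ≤ 1 / T := by
    calc ∑ i, w i ^ 2 ≤ ∑ i, w i * (1 / T) :=
          Finset.sum_le_sum fun i _ => by
            rw [sq]; exact mul_le_mul_of_nonneg_left (hwT i) (hw i)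
      _ = 1 / T := by rw [← Finset.sum_mul, hw1, one_mul]
  have h2 : 0 < ∑ i, w i ^ 2 := by
    obtain ⟨i, -, hi⟩ : ∃ i ∈ Finset.univ, w i ≠ 0 := by
      by_contra! hc
      rw [Finset.sum_eq_zero hc] at hw1
      norm_num at hw1
    exact Finset.sum_pos' (fun i _ => sq_nonneg _) ⟨i, Finset.mem_univ i, by positivity⟩
  rw [neg_div, neg_le_neg_iff, le_div_iff₀ (by positivity)]
  rw [le_div_iff₀ hT] at h1
  nlinarith [sq_nonneg ε]

/-- The lower-tail version of `real_weighted_sum_ge_le`. -/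
lemma real_weighted_sum_le_le {ι : Type*} [Fintype ι] {Ω : ι → Type*}
    [∀ i, MeasurableSpace (Ω i)] (ν : (i : ι) → Measure (Ω i)) [∀ i, IsProbabilityMeasure (ν i)]
    {f : (i : ι) → Ω i → ℝ} (hf : ∀ i, Measurable (f i)) (hf01 : ∀ i ω, f i ω ∈ Set.Icc (0 : ℝ) 1)
    {w : ι → ℝ} (hw : ∀ i, 0 ≤ w i) (hw1 : ∑ i, w i = 1) {T : ℝ} (hT : 0 < T)
    (hwT : ∀ i, w i ≤ 1 / T) {ε : ℝ} (hε : 0 ≤ ε) :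
    (Measure.pi ν).real {y | ∑ i, w i * (f i (y i) - ∫ ω, f i ω ∂ν i) ≤ -ε} ≤
      Real.exp (-(2 * ε ^ 2 * T)) := by
  have key := real_weighted_sum_ge_le ν (f := fun i ω => 1 - f i ω)
    (fun i => (hf i).const_sub 1)
    (fun i ω => ⟨by linarith [(hf01 i ω).2], by linarith [(hf01 i ω).1]⟩) hw hw1 hT hwT hε
  refine le_trans (le_of_eq ?_) key
  congr 1
  ext y
  simp only [Set.mem_ofPred_eq]
  have : ∀ i, ∫ ω, (1 - f i ω) ∂ν i = 1 - ∫ ω, f i ω ∂ν i := fun i => by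
    rw [integral_sub (integrable_const _)
      (Integrable.of_mem_Icc 0 1 (hf i).aemeasurable (ae_of_all _ (hf01 i)))]
    simp
  simp only [this]
  have h2 : ∑ i, w i * (1 - f i (y i) - (1 - ∫ ω, f i ω ∂ν i)) =
      -∑ i, w i * (f i (y i) - ∫ ω, f i ω ∂ν i) := by
    rw [← Finset.sum_neg_distrib]
    exact Finset.sum_congr rfl fun i _ => by ring
  rw [h2]
  constructor <;> intro h <;> linarith

end Concentration

/-! ### Conditioning a product law on all covariates at once. -/

section Disintegration

/-- A set has small measure under `⨂ (μ i ⊗ₘ κ)` as soon as its sections have small measure under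
`⨂ κ (x i)`. -/
lemma pi_compProd_le {E ι : Type*} [MeasurableSpace E] [Fintype ι] (μ : ι → Measure E)
    [∀ i, IsProbabilityMeasure (μ i)] (κ : Kernel E ℝ) [IsMarkovKernel κ]
    {B : Set (ι → E × ℝ)} (hB : MeasurableSet B) {c : ℝ≥0∞}
    (h : ∀ᵐ x ∂(Measure.pi μ), Measure.pi (fun i => κ (x i)) {y | (fun i => (x i, y i)) ∈ B} ≤ c) :
    Measure.pi (fun i => μ i ⊗ₘ κ) B ≤ c := by
  -- Each response is realised as `g x u` with `u` uniform and independent of `x`. The product of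
  -- the `μ i ⊗ₘ κ` becomes the image of a product measure, in which covariates and noises can be
  -- separated by Fubini.
  obtain ⟨g, hg, hgκ⟩ := Kernel.exists_measurable_map_eq_unitInterval κ
  have hg' : Measurable fun q : E × unitInterval => (q.1, g q.1 q.2) :=
    measurable_fst.prodMk hg
  have hmap : ∀ i, ((μ i).prod (volume : Measure unitInterval)).map (fun q => (q.1, g q.1 q.2)) =
      μ i ⊗ₘ κ := by
    intro i
    ext s hs
    rw [Measure.map_apply hg' hs, Measure.prod_apply (hg' hs), Measure.compProd_apply hs]
    refine lintegral_congr fun x => ?_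
    rw [← hgκ x, Measure.map_apply (hg.of_uncurry_left) (measurable_prodMk_left hs)]
    rfl
  simp_rw [← hmap]
  have hsf : ∀ i, SigmaFinite (((μ i).prod (volume : Measure unitInterval)).map
      (fun q => (q.1, g q.1 q.2))) := fun i => by rw [hmap i]; infer_instance
  rw [← Measure.pi_map_pi (fun i => hg'.aemeasurable)]
  have hm2 : Measurable fun (q : ι → E × unitInterval) (i : ι) => ((q i).1, g (q i).1 (q i).2) :=
    measurable_pi_lambda _ fun i => hg'.comp (measurable_pi_apply i)
  rw [Measure.map_apply hm2 hB]
  have hmp := (measurePreserving_arrowProdEquivProdArrow E unitInterval ι μ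
    (fun _ => volume)).symm
  rw [← hmp.measure_preimage (hm2 hB).nullMeasurableSet,
    Measure.prod_apply (hmp.measurable (hm2 hB))]
  have hle : ∀ᵐ x ∂(Measure.pi μ), Measure.pi (fun _ : ι => (volume : Measure unitInterval))
      (Prod.mk x ⁻¹' ((MeasurableEquiv.arrowProdEquivProdArrow E unitInterval ι).symm ⁻¹'
        ((fun (q : ι → E × unitInterval) (i : ι) => ((q i).1, g (q i).1 (q i).2)) ⁻¹' B))) ≤ c := by
    filter_upwards [h] with x hx
    refine le_trans (le_of_eq ?_) hx
    simp_rw [← hgκ]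
    have hsf : ∀ i, SigmaFinite ((volume : Measure unitInterval).map (g (x i))) :=
      fun i => by rw [hgκ]; infer_instance
    have hm3 : Measurable fun (y : ι → ℝ) (i : ι) => (x i, y i) := by fun_prop
    change _ = Measure.pi (fun i => (volume : Measure unitInterval).map (g (x i)))
      ((fun (y : ι → ℝ) (i : ι) => (x i, y i)) ⁻¹' B)
    rw [← Measure.pi_map_pi (fun i => (hg.of_uncurry_left (x := x i)).aemeasurable),
      Measure.map_apply (show Measurable fun (y : ι → unitInterval) (i : ι) => g (x i) (y i) from
        measurable_pi_lambda _ fun i =>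
          (hg.of_uncurry_left (x := x i)).comp (measurable_pi_apply i)) (hm3 hB)]
    rfl
  refine (lintegral_mono_ae hle).trans ?_
  simp

end Disintegration

/-! ### Size of the localizer near and far from its centre. -/

section Localizer

variable {E : Type*} {d : E → E → ℝ≥0∞} {h : ℝ}

lemma localizer_nonneg (d : E → E → ℝ≥0∞) (h : ℝ) (x y : E) : 0 ≤ localizer d h x y := by
  unfold localizer
  split_ifs <;> positivity

lemma localizer_le_one (hh : 0 < h) (x y : E) : localizer d h x y ≤ 1 := by
  unfold localizer
  split_ifs
  · exact zero_le_one
  · rw [Real.exp_le_one_iff, neg_div]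
    exact neg_nonpos.2 (div_nonneg ENNReal.toReal_nonneg hh.le)

lemma exp_neg_one_le_localizer (hh : 0 < h) {x y : E} (hd : d x y ≤ ENNReal.ofReal h) :
    Real.exp (-1) ≤ localizer d h x y := by
  rw [localizer, if_neg (ne_top_of_le_ne_top ENNReal.ofReal_ne_top hd), Real.exp_le_exp,
    neg_div, neg_le_neg_iff, div_le_one hh]
  exact ENNReal.toReal_le_of_le_ofReal hh.le hd

lemma localizer_le_exp_of_lt (hh : 0 < h) {x y : E} {r : ℝ}
    (hd : ENNReal.ofReal r < d x y) : localizer d h x y ≤ Real.exp (-r / h) := by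
  unfold localizer
  split_ifs with htop
  · positivity
  · rw [Real.exp_le_exp, neg_div, neg_div, neg_le_neg_iff]
    have := (ENNReal.ofReal_le_iff_le_toReal htop).1 hd.le
    gcongr

lemma measurable_localizer [MeasurableSpace E] (hd : Measurable (Function.uncurry d)) :
    Measurable (Function.uncurry (localizer d h)) := by
  have : Function.uncurry (localizer d h) = fun q : E × E =>
      if Function.uncurry d q = ⊤ then 0
      else Real.exp (-(Function.uncurry d q).toReal / h) := by
    ext ⟨x, y⟩
    rfl
  rw [this]
  exact Measurable.ite (hd (measurableSet_singleton ⊤)) measurable_const (by fun_prop)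

end Localizer

/-! ### Chernoff lower bound for the row sums. -/

section RowSums

variable {E : Type*} [MeasurableSpace E] {n : ℕ}

/-- The decay rate `1 - exp(-1/e)` in the lower-tail bound for the row sums. -/
noncomputable def rowRate : ℝ := 1 - Real.exp (-Real.exp (-1))

lemma rowRate_pos : 0 < rowRate := by
  rw [rowRate, sub_pos, Real.exp_lt_one_iff, neg_lt_zero]
  positivity

/-- Pointwise, `exp (-g)` is at most `1 - rowRate` where `g ≥ exp (-1)` and at most `1` elsewhere;
then `1 - x ≤ exp (-x)`. -/
lemma integral_exp_neg_le {ν : Measure E} [IsProbabilityMeasure ν] {g : E → ℝ}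
    (hg : Measurable g) (hg0 : ∀ y, 0 ≤ g y) {q : ℝ}
    (hq : q ≤ ν.real {y | Real.exp (-1) ≤ g y}) :
    ∫ y, Real.exp (-g y) ∂ν ≤ Real.exp (-(rowRate * q)) := by
  have hA : MeasurableSet {y | Real.exp (-1) ≤ g y} := measurableSet_le measurable_const hg
  have hint : Integrable (fun y => 1 - rowRate *
      Set.indicator {y | Real.exp (-1) ≤ g y} (fun _ => (1 : ℝ)) y) ν :=
    (integrable_const _).sub (((integrable_const _).indicator hA).const_mul _)
  have h1 : ∫ y, Real.exp (-g y) ∂ν ≤ ∫ y, (1 - rowRate *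
      Set.indicator {y | Real.exp (-1) ≤ g y} (fun _ => (1 : ℝ)) y) ∂ν := by
    refine integral_mono_of_nonneg (ae_of_all _ fun y => (Real.exp_pos _).le) hint
      (ae_of_all _ fun y => ?_)
    dsimp only
    by_cases hy : y ∈ {y | Real.exp (-1) ≤ g y}
    · rw [Set.indicator_of_mem hy, rowRate, mul_one, sub_sub_cancel, Real.exp_le_exp,
        neg_le_neg_iff]
      exact hy
    · rw [Set.indicator_of_notMem hy, mul_zero, sub_zero, Real.exp_le_one_iff]
      linarith [hg0 y]
  have h2 : ∫ y, (1 - rowRate *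
      Set.indicator {y | Real.exp (-1) ≤ g y} (fun _ => (1 : ℝ)) y) ∂ν =
      1 - rowRate * ν.real {y | Real.exp (-1) ≤ g y} := by
    rw [integral_sub (integrable_const _) (((integrable_const _).indicator hA).const_mul _),
      integral_const_mul, integral_indicator_const _ hA]
    simp
  have h3 := Real.add_one_le_exp (-(rowRate * q))
  have h4 := mul_le_mul_of_nonneg_left hq rowRate_pos.le
  linarith

/-- Among the `n` indices other than `i`, at most one is the last, whose covariate is frozen; at
least `n - 1` contribute decay. -/
lemma sum_succAbove_ge {c : ℝ} (hc : 0 ≤ c) (i : Fin (n + 1)) :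
    c * ((n : ℝ) - 1) ≤ ∑ j, (if i.succAbove j = Fin.last n then 0 else c) := by
  have h1 := Fin.sum_univ_succAbove (fun k => if k = Fin.last n then 0 else c) i
  have h2 : ∑ k : Fin (n + 1), (if k = Fin.last n then 0 else c) = n * c := by
    rw [Fin.sum_univ_castSucc]
    simp [Fin.castSucc_ne_last]
  have h3 : (if i = Fin.last n then 0 else c) ≤ c := by split_ifs <;> linarith
  rw [h2] at h1
  linarith

/-- Once `X i` is fixed, the other terms of its row are independent and the Laplace transform
factorises. The diagonal term is nonnegative and is dropped. -/
lemma integral_exp_neg_rowSum_le (μ : Fin (n + 1) → Measure E) [∀ i, IsProbabilityMeasure (μ i)]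
    {H : E → E → ℝ} (hH : Measurable (Function.uncurry H)) (hH0 : ∀ x y, 0 ≤ H x y)
    {D : Set E} {i : Fin (n + 1)} (hD : ∀ᵐ x ∂μ i, x ∈ D) {q : ℝ} (hq0 : 0 ≤ q)
    (hq : ∀ x ∈ D, ∀ k, k ≠ Fin.last n → q ≤ (μ k).real {y | Real.exp (-1) ≤ H x y}) :
    ∫ X, Real.exp (-∑ k, H (X i) (X k)) ∂(Measure.pi μ) ≤
      Real.exp (-(rowRate * q * ((n : ℝ) - 1))) := by
  let g : E × (Fin n → E) → ℝ := fun ab => ∏ j, Real.exp (-H ab.1 (ab.2 j))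
  have hgm : Measurable g := Finset.measurable_prod _ fun j _ =>
    (hH.comp (measurable_fst.prodMk ((measurable_pi_apply j).comp measurable_snd))).neg.exp
  have hg01 : ∀ ab, g ab ∈ Set.Icc (0 : ℝ) 1 := fun ab =>
    ⟨Finset.prod_nonneg fun j _ => (Real.exp_pos _).le,
      Finset.prod_le_one (fun j _ => (Real.exp_pos _).le) fun j _ => by
        rw [Real.exp_le_one_iff]; linarith [hH0 ab.1 (ab.2 j)]⟩
  have hmp := measurePreserving_piFinSuccAbove μ i
  have hgi : Integrable g ((μ i).prod (Measure.pi fun j => μ (i.succAbove j))) :=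
    Integrable.of_mem_Icc 0 1 hgm.aemeasurable (ae_of_all _ hg01)
  have h1 : ∫ X, Real.exp (-∑ k, H (X i) (X k)) ∂(Measure.pi μ) ≤
      ∫ X, g (MeasurableEquiv.piFinSuccAbove (fun _ => E) i X) ∂(Measure.pi μ) := by
    refine integral_mono_of_nonneg (ae_of_all _ fun X => (Real.exp_pos _).le)
      (hmp.integrable_comp_of_integrable hgi) (ae_of_all _ fun X => ?_)
    change _ ≤ ∏ j, Real.exp (-H (X i) (X (i.succAbove j)))
    rw [← Real.exp_sum, Finset.sum_neg_distrib]
    dsimp only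
    rw [Real.exp_le_exp, neg_le_neg_iff, Fin.sum_univ_succAbove _ i]
    linarith [hH0 (X i) (X i)]
  refine h1.trans ?_
  rw [hmp.integral_comp', integral_prod _ hgi]
  have h2 : ∀ᵐ a ∂μ i, ∫ b, g (a, b) ∂(Measure.pi fun j => μ (i.succAbove j)) ≤
      Real.exp (-(rowRate * q * ((n : ℝ) - 1))) := by
    filter_upwards [hD] with a ha
    have hHa : Measurable (H a) := hH.of_uncurry_left
    change ∫ b : Fin n → E, ∏ j, Real.exp (-H a (b j)) ∂_ ≤ _
    rw [integral_fintype_prod_eq_prod (fun _ y => Real.exp (-H a y))]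
    calc ∏ j, ∫ y, Real.exp (-H a y) ∂μ (i.succAbove j)
        ≤ ∏ j, Real.exp (-(if i.succAbove j = Fin.last n then 0 else rowRate * q)) := by
          refine Finset.prod_le_prod
            (fun j _ => integral_nonneg fun y => (Real.exp_pos _).le) fun j _ => ?_
          split_ifs with hj
          · have := integral_exp_neg_le (ν := μ (i.succAbove j)) hHa (hH0 a) (q := 0)
              measureReal_nonneg
            simpa using this
          · exact integral_exp_neg_le hHa (hH0 a) (hq a ha _ hj)
      _ = Real.exp (-∑ j, (if i.succAbove j = Fin.last n then 0 else rowRate * q)) := by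
          rw [← Real.exp_sum, Finset.sum_neg_distrib]
      _ ≤ _ := by
          rw [Real.exp_le_exp, neg_le_neg_iff]
          exact sum_succAbove_ge (mul_nonneg rowRate_pos.le hq0) i
  refine (integral_mono_ae hgi.integral_prod_left (integrable_const _) h2).trans ?_
  simp

lemma measurable_rowSum {H : E → E → ℝ} (hH : Measurable (Function.uncurry H)) (i : Fin (n + 1)) :
    Measurable fun X : Fin (n + 1) → E => ∑ k, H (X i) (X k) :=
  Finset.measurable_sum _ fun k _ =>
    hH.comp (f := fun X : Fin (n + 1) → E => (X i, X k))
      ((measurable_pi_apply i).prodMk (measurable_pi_apply k))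

/-- Lower-tail bound for the row sums of the localizer. -/
lemma real_rowSum_lt_le (μ : Fin (n + 1) → Measure E) [∀ i, IsProbabilityMeasure (μ i)]
    {H : E → E → ℝ} (hH : Measurable (Function.uncurry H)) (hH0 : ∀ x y, 0 ≤ H x y)
    {D : Set E} {i : Fin (n + 1)} (hD : ∀ᵐ x ∂μ i, x ∈ D) {q : ℝ} (hq0 : 0 ≤ q)
    (hq : ∀ x ∈ D, ∀ k, k ≠ Fin.last n → q ≤ (μ k).real {y | Real.exp (-1) ≤ H x y}) (T : ℝ) :
    (Measure.pi μ).real {X | ∑ k, H (X i) (X k) < T} ≤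
      Real.exp (T - rowRate * q * ((n : ℝ) - 1)) := by
  have hm : Measurable fun X : Fin (n + 1) → E => Real.exp (-∑ k, H (X i) (X k)) :=
    (measurable_rowSum hH i).neg.exp
  have hint : Integrable (fun X : Fin (n + 1) → E => Real.exp (-∑ k, H (X i) (X k)))
      (Measure.pi μ) :=
    Integrable.of_mem_Icc 0 1 hm.aemeasurable (ae_of_all _ fun X => ⟨(Real.exp_pos _).le, by
      rw [Real.exp_le_one_iff]
      linarith [Finset.sum_nonneg fun k (_ : k ∈ Finset.univ) => hH0 (X i) (X k)]⟩)
  -- Markov's inequality for the exponential of minus the row sum.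
  have h1 := mul_meas_ge_le_integral_of_nonneg
    (ae_of_all (Measure.pi μ) fun X => (Real.exp_pos (-∑ k, H (X i) (X k))).le) hint
    (Real.exp (-T))
  have h2 := integral_exp_neg_rowSum_le μ hH hH0 hD hq0 hq
  have h3 : (Measure.pi μ).real {X | ∑ k, H (X i) (X k) < T} ≤
      (Measure.pi μ).real {X | Real.exp (-T) ≤ Real.exp (-∑ k, H (X i) (X k))} :=
    measureReal_mono fun X hX => by
      have hX : ∑ k, H (X i) (X k) < T := hX
      change Real.exp (-T) ≤ _
      rw [Real.exp_le_exp]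
      linarith
  calc _ ≤ _ := h3
    _ = Real.exp T * (Real.exp (-T) *
        (Measure.pi μ).real {X | Real.exp (-T) ≤ Real.exp (-∑ k, H (X i) (X k))}) := by
      rw [← mul_assoc, ← Real.exp_add, add_neg_cancel, Real.exp_zero, one_mul]
    _ ≤ Real.exp T * Real.exp (-(rowRate * q * ((n : ℝ) - 1))) :=
      mul_le_mul_of_nonneg_left (h1.trans h2) (Real.exp_pos _).le
    _ = _ := by rw [← Real.exp_add, ← sub_eq_add_neg]

end RowSums

/-! ### Bounds on weights and the smoothing bias. -/

section WeightBounds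

variable {E : Type*} {n : ℕ}

lemma weight_le_div {H : E → E → ℝ} {X : Fin (n + 1) → E} {i : Fin (n + 1)} {T c : ℝ}
    (hT : 0 < T) (hrow : T ≤ ∑ k, H (X i) (X k)) (hc : 0 ≤ c) {j : Fin (n + 1)}
    (hj : H (X i) (X j) ≤ c) : weight H X i j ≤ c / T := by
  unfold weight
  gcongr

lemma monotone_weightedCDF {H : E → E → ℝ} (hH : ∀ x y, 0 ≤ H x y) (X : Fin (n + 1) → E)
    (i : Fin (n + 1)) (S : Fin (n + 1) → ℝ) : Monotone (weightedCDF H X i S) := by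
  intro s t hst
  refine Finset.sum_le_sum fun j _ => mul_le_mul_of_nonneg_left ?_ (weight_nonneg hH X i j)
  split_ifs with h1 h2
  · exact le_rfl
  · exact absurd (h1.trans hst) h2
  · exact zero_le_one
  · exact le_rfl

lemma weightedCDF_nonneg {H : E → E → ℝ} (hH : ∀ x y, 0 ≤ H x y) (X : Fin (n + 1) → E)
    (i : Fin (n + 1)) (S : Fin (n + 1) → ℝ) (t : ℝ) : 0 ≤ weightedCDF H X i S t :=
  Finset.sum_nonneg fun j _ => mul_nonneg (weight_nonneg hH X i j) (by split_ifs <;> norm_num)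

lemma weightedCDF_le_one {H : E → E → ℝ} (hH : ∀ x y, 0 ≤ H x y) {X : Fin (n + 1) → E}
    {i : Fin (n + 1)} (hrow : 0 < ∑ k, H (X i) (X k)) (S : Fin (n + 1) → ℝ) (t : ℝ) :
    weightedCDF H X i S t ≤ 1 := by
  rw [← sum_weight hrow]
  refine Finset.sum_le_sum fun j _ => mul_le_of_le_one_right (weight_nonneg hH X i j) ?_
  split_ifs <;> norm_num

/-- The bias of the localized average of a family of functions that is Lipschitz in `d`. -/
lemma abs_sum_weight_mul_sub_le {d : E → E → ℝ≥0∞} {h : ℝ} (hh : 0 < h) {X : Fin (n + 1) → E}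
    {i : Fin (n + 1)} {T : ℝ} (hT : 0 < T) (hrow : T ≤ ∑ k, localizer d h (X i) (X k))
    {φ : Fin (n + 1) → ℝ} (hφ0 : ∀ j, 0 ≤ φ j) (hφ1 : ∀ j, φ j ≤ 1) {L : ℝ} (hL : 0 ≤ L)
    (hLip : ∀ j, ENNReal.ofReal |φ i - φ j| ≤ ENNReal.ofReal L * d (X i) (X j))
    {r : ℝ} (hr : 0 ≤ r) :
    |∑ j, weight (localizer d h) X i j * (φ j - φ i)| ≤
      L * r + ((n : ℝ) + 1) * (Real.exp (-r / h) / T) := by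
  have hw := weight_nonneg (localizer_nonneg d h) X i
  -- Points within distance `r` are handled by the Lipschitz bound, the others by their small weight
  -- and `|φ j - φ i| ≤ 1`.
  have hterm : ∀ j, |weight (localizer d h) X i j * (φ j - φ i)| ≤
      weight (localizer d h) X i j * (L * r) + Real.exp (-r / h) / T := by
    intro j
    rw [abs_mul, abs_of_nonneg (hw j), abs_sub_comm]
    have hpos : 0 ≤ Real.exp (-r / h) / T := by positivity
    by_cases hd : d (X i) (X j) ≤ ENNReal.ofReal r
    · have h1 : |φ i - φ j| ≤ L * r := by
        rw [← ENNReal.ofReal_le_ofReal_iff (by positivity), ENNReal.ofReal_mul hL]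
        exact (hLip j).trans (by gcongr)
      linarith [mul_le_mul_of_nonneg_left h1 (hw j)]
    · have h1 : |φ i - φ j| ≤ 1 := by
        rw [abs_le]
        constructor <;> linarith [hφ0 i, hφ1 i, hφ0 j, hφ1 j]
      have h2 := weight_le_div hT hrow (Real.exp_pos _).le
        (localizer_le_exp_of_lt hh (not_le.1 hd))
      have h3 := mul_le_mul_of_nonneg_left h1 (hw j)
      have h4 := mul_nonneg (hw j) (mul_nonneg hL hr)
      linarith
  refine (Finset.abs_sum_le_sum_abs _ _).trans ((Finset.sum_le_sum fun j _ => hterm j).trans ?_)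
  rw [Finset.sum_add_distrib, ← Finset.sum_mul, sum_weight (hT.trans_le hrow), one_mul]
  simp

end WeightBounds

/-! ### Uniform closeness of weighted distribution functions, given the covariates. -/

section CondCDF

variable {E : Type*} [MeasurableSpace E] {κ : Kernel E ℝ} [IsMarkovKernel κ] {V : E × ℝ → ℝ}

lemma measurable_condCDF (hV : Measurable V) :
    Measurable fun q : E × ℝ => condCDF κ V q.1 q.2 := by
  have hs : MeasurableSet {q : (E × ℝ) × ℝ | V (q.1.1, q.2) ≤ q.1.2} :=
    measurableSet_le (hV.comp (by fun_prop)) (by fun_prop)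
  have := Kernel.measurable_kernel_prodMk_left (κ := κ.comap (Prod.fst : E × ℝ → E) measurable_fst)
    hs
  exact this.ennreal_toReal

lemma condCDF_nonneg {κ : Kernel E ℝ} (x : E) (v : ℝ) : 0 ≤ condCDF κ V x v := measureReal_nonneg

lemma condCDF_le_one (x : E) (v : ℝ) : condCDF κ V x v ≤ 1 := measureReal_le_one

lemma monotone_condCDF (x : E) : Monotone (condCDF κ V x) :=
  monotone_real_setOf_le (ν := κ x) (W := fun y => V (x, y))

lemma continuous_condCDF (hV : Measurable V) {x : E} (h0 : ∀ v, κ x {y | V (x, y) = v} = 0) :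
    Continuous (condCDF κ V x) :=
  continuous_real_setOf_le (ν := κ x) (W := fun y => V (x, y)) (hV.comp measurable_prodMk_left) h0

/-- The conditional law of the weighted distribution functions given the covariates: they are
uniformly close to the conditional distribution functions of the scores. -/
lemma pi_real_exists_lt_abs_weightedCDF_sub_le {n : ℕ} (hV : Measurable V)
    {H : E → E → ℝ} (hH0 : ∀ x y, 0 ≤ H x y) (hH1 : ∀ x y, H x y ≤ 1) {X : Fin (n + 1) → E}
    (hcont : ∀ j v, κ (X j) {y | V (X j, y) = v} = 0) {T : ℝ} (hT : 0 < T)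
    (hrow : ∀ i, T ≤ ∑ k, H (X i) (X k)) {b : ℝ}
    (hb : ∀ i t, |∑ j, weight H X i j * (condCDF κ V (X j) t - condCDF κ V (X i) t)| ≤ b)
    {ε : ℝ} (hε : 0 ≤ ε) {K : ℕ} (hK : 0 < K) :
    (Measure.pi fun j => κ (X j)).real {y | ∃ i, ∃ t : ℝ, ε + b + 2 / K <
        |weightedCDF H X i (fun j => V (X j, y j)) t - condCDF κ V (X i) t|} ≤
      ((n : ℝ) + 1) * (K * (2 * Real.exp (-(2 * ε ^ 2 * T)))) := by
  have hVx : ∀ x, Measurable fun y => V (x, y) := fun x => hV.comp measurable_prodMk_left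
  have hb0 : 0 ≤ b := (abs_nonneg _).trans (hb 0 0)
  -- The covariates are fixed here, so the quantile grid of each row is deterministic and a union
  -- bound over its points is legitimate.
  have hτ : ∀ i, ∃ τ : ℕ → ℝ, ∀ k, 0 < k → k < K → condCDF κ V (X i) (τ k) = k / K := by
    intro i
    have hK' : (0 : ℝ) < K := by exact_mod_cast hK
    have : ∀ k : ℕ, ∃ t, 0 < k → k < K → condCDF κ V (X i) t = k / K := by
      intro k
      by_cases hk : 0 < k ∧ k < K
      · obtain ⟨t, ht⟩ := exists_real_setOf_le_eq (ν := κ (X i)) (hVx (X i)) (hcont i)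
          (s := k / K) ⟨div_pos (by exact_mod_cast hk.1) hK',
            (div_lt_one hK').2 (by exact_mod_cast hk.2)⟩
        exact ⟨t, fun _ _ => ht⟩
      · exact ⟨0, fun h1 h2 => absurd ⟨h1, h2⟩ hk⟩
    choose τ hτ using this
    exact ⟨τ, hτ⟩
  choose τ hτ using hτ
  let f : ℝ → (j : Fin (n + 1)) → ℝ → ℝ := fun t j y => if V (X j, y) ≤ t then 1 else 0
  have hfm : ∀ t j, Measurable (f t j) := fun t j =>
    Measurable.ite (measurableSet_le (hVx _) measurable_const) measurable_const measurable_const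
  have hf01 : ∀ t j y, f t j y ∈ Set.Icc (0 : ℝ) 1 := fun t j y => by
    dsimp only [f]; split_ifs <;> norm_num
  have hfi : ∀ t j, ∫ y, f t j y ∂κ (X j) = condCDF κ V (X j) t := fun t j => by
    have hms : MeasurableSet {y | V (X j, y) ≤ t} := measurableSet_le (hVx _) measurable_const
    have : f t j = Set.indicator {y | V (X j, y) ≤ t} (fun _ => (1 : ℝ)) := by
      ext y; simp [f, Set.indicator_apply]
    rw [this, integral_indicator_const _ hms]
    simp [condCDF]
  let Up : Fin (n + 1) → ℕ → Set (Fin (n + 1) → ℝ) := fun i k =>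
    {y | ε ≤ ∑ j, weight H X i j * (f (τ i k) j (y j) - ∫ y, f (τ i k) j y ∂κ (X j))}
  let Lo : Fin (n + 1) → ℕ → Set (Fin (n + 1) → ℝ) := fun i k =>
    {y | ∑ j, weight H X i j * (f (τ i k) j (y j) - ∫ y, f (τ i k) j y ∂κ (X j)) ≤ -ε}
  have hw := weight_nonneg hH0 X
  have hwT : ∀ i j, weight H X i j ≤ 1 / T := fun i j =>
    weight_le_div hT (hrow i) zero_le_one (hH1 _ _)
  have hsum : ∀ i, ∑ j, weight H X i j = 1 := fun i => sum_weight (hT.trans_le (hrow i))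
  have hsub : {y : Fin (n + 1) → ℝ | ∃ i, ∃ t : ℝ, ε + b + 2 / K <
        |weightedCDF H X i (fun j => V (X j, y j)) t - condCDF κ V (X i) t|} ⊆
      ⋃ i ∈ Finset.univ, ⋃ k ∈ Finset.range K, (Up i k ∪ Lo i k) := by
    rintro y ⟨i, t, hit⟩
    by_contra hy
    simp only [Set.mem_iUnion, not_exists, Set.mem_union, not_or] at hy
    refine absurd hit (not_lt.2 (abs_sub_le_of_grid (monotone_weightedCDF hH0 X i _)
      (monotone_condCDF _) (weightedCDF_nonneg hH0 X i _)
      (weightedCDF_le_one hH0 (hT.trans_le (hrow i)) _)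
      (condCDF_nonneg _) (condCDF_le_one _) hK (hτ i) (add_nonneg hε hb0) (fun k _ hk => ?_) t))
    obtain ⟨h1, h2⟩ := hy i (Finset.mem_univ i) k (Finset.mem_range.2 hk)
    have h3 := abs_le.1 (hb i (τ i k))
    simp only [Up, Lo, hfi, Set.mem_ofPred_eq, not_le] at h1 h2
    -- Centred fluctuation, controlled by Hoeffding's inequality, plus smoothing bias, controlled by
    -- `b`.
    have key : weightedCDF H X i (fun j => V (X j, y j)) (τ i k) - condCDF κ V (X i) (τ i k) =
        ∑ j, weight H X i j * (f (τ i k) j (y j) - condCDF κ V (X j) (τ i k)) +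
        ∑ j, weight H X i j * (condCDF κ V (X j) (τ i k) - condCDF κ V (X i) (τ i k)) := by
      rw [← Finset.sum_add_distrib, weightedCDF]
      simp only [mul_sub, Finset.sum_add_distrib, Finset.sum_sub_distrib]
      rw [← Finset.sum_mul (f := fun j => weight H X i j) (a := condCDF κ V (X i) (τ i k)), hsum]
      dsimp only [f]
      ring
    rw [key, abs_le]
    constructor <;> linarith
  have hUL : ∀ i k, (Measure.pi fun j => κ (X j)).real (Up i k ∪ Lo i k) ≤
      2 * Real.exp (-(2 * ε ^ 2 * T)) := by
    intro i k
    refine (measureReal_union_le _ _).trans ?_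
    rw [two_mul]
    exact add_le_add
      (real_weighted_sum_ge_le _ (hfm (τ i k)) (hf01 _) (hw i) (hsum i) hT (hwT i) hε)
      (real_weighted_sum_le_le _ (hfm (τ i k)) (hf01 _) (hw i) (hsum i) hT (hwT i) hε)
  refine (measureReal_mono hsub (measure_ne_top _ _)).trans ((measureReal_biUnion_finset_le _ _).trans ?_)
  calc _ ≤ ∑ i : Fin (n + 1), (K * (2 * Real.exp (-(2 * ε ^ 2 * T))) : ℝ) := by
        refine Finset.sum_le_sum fun i _ => (measureReal_biUnion_finset_le _ _).trans ?_
        refine (Finset.sum_le_sum fun k _ => hUL i k).trans ?_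
        simp
    _ = _ := by simp

end CondCDF

/-! ### The conditional law as a product of disintegrated laws. -/

section CondLaw

variable {E : Type*} [MeasurableSpace E]

/-- The law of the covariate of index `k` given that the last covariate is `x₀`. -/
noncomputable def covLaw (P : Measure (E × ℝ)) (n : ℕ) (x₀ : E) (k : Fin (n + 1)) : Measure E :=
  if k = Fin.last n then Measure.dirac x₀ else P.fst

variable {P : Measure (E × ℝ)} {κ : Kernel E ℝ} [IsMarkovKernel κ] {n : ℕ} {x₀ : E}

instance isProbabilityMeasure_covLaw [IsProbabilityMeasure P] (k : Fin (n + 1)) :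
    IsProbabilityMeasure (covLaw P n x₀ k) := by
  unfold covLaw
  split_ifs <;> infer_instance

lemma ae_covLaw_mem {D : Set E} (hD : MeasurableSet D) (hP : ∀ᵐ x ∂P.fst, x ∈ D) (hx₀ : x₀ ∈ D)
    (k : Fin (n + 1)) : ∀ᵐ x ∂covLaw P n x₀ k, x ∈ D := by
  unfold covLaw
  split_ifs
  · exact (ae_dirac_iff hD).2 hx₀
  · exact hP

/-- Conditioning only replaces the last covariate law by a Dirac mass; the same kernel `κ` then
serves every coordinate, so all estimates treat them alike. -/
lemma condLaw_eq_pi_compProd [MeasurableSingletonClass E] (hκ : P.fst ⊗ₘ κ = P) :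
    condLaw P κ n x₀ = Measure.pi fun k => covLaw P n x₀ k ⊗ₘ κ := by
  unfold condLaw covLaw
  congr 1
  ext1 k
  split_ifs
  · ext s hs
    rw [Measure.dirac_compProd_apply hs, Measure.dirac_prod,
      Measure.map_apply measurable_prodMk_left hs]
  · exact hκ.symm

lemma measurePreserving_covariates (μ : Fin (n + 1) → Measure E)
    [∀ i, IsProbabilityMeasure (μ i)] :
    MeasurePreserving (fun (z : Fin (n + 1) → E × ℝ) i => (z i).1)
      (Measure.pi fun k => μ k ⊗ₘ κ) (Measure.pi μ) := by
  have hfst : ∀ k, (μ k ⊗ₘ κ).map Prod.fst = μ k := fun k => Measure.fst_compProd (μ k) κ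
  refine ⟨by fun_prop, ?_⟩
  have : ∀ k, SigmaFinite ((μ k ⊗ₘ κ).map Prod.fst) := fun k => by rw [hfst]; infer_instance
  rw [Measure.pi_map_pi (f := fun _ => Prod.fst) (fun k => measurable_fst.aemeasurable)]
  simp_rw [hfst]

end CondLaw

/-! ### The probability integral transform averaged over the covariate. -/

section Transform

variable {E : Type*} [MeasurableSpace E] {κ : Kernel E ℝ} [IsMarkovKernel κ] {V : E × ℝ → ℝ}
  {D : Set E} {μ : Measure E} [IsProbabilityMeasure μ]

lemma measurable_transform (hV : Measurable V) :
    Measurable fun z : E × ℝ => condCDF κ V z.1 (V z) :=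
  (measurable_condCDF hV).comp (measurable_fst.prodMk hV)

lemma compProd_real_transform_lt_le (hV : Measurable V)
    (hcont : ∀ x ∈ D, ∀ v : ℝ, κ x {y | V (x, y) = v} = 0) (hD : ∀ᵐ x ∂μ, x ∈ D)
    {s : ℝ} (hs : s ∈ Set.Ioo (0 : ℝ) 1) :
    (μ ⊗ₘ κ).real {z | condCDF κ V z.1 (V z) < s} ≤ s := by
  have hm : MeasurableSet {z : E × ℝ | condCDF κ V z.1 (V z) < s} :=
    measurableSet_lt (measurable_transform hV) measurable_const
  refine ENNReal.toReal_le_of_le_ofReal hs.1.le ?_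
  rw [Measure.compProd_apply hm]
  calc _ ≤ ∫⁻ _, ENNReal.ofReal s ∂μ := by
        refine lintegral_mono_ae ?_
        filter_upwards [hD] with x hx
        rw [← ofReal_measureReal]
        exact ENNReal.ofReal_le_ofReal (real_transform_lt_le (ν := κ x) (W := fun y => V (x, y))
          (hV.comp measurable_prodMk_left) (hcont x hx) hs)
    _ = _ := by simp

lemma le_compProd_real_transform_le (hV : Measurable V)
    (hcont : ∀ x ∈ D, ∀ v : ℝ, κ x {y | V (x, y) = v} = 0) (hD : ∀ᵐ x ∂μ, x ∈ D)
    {s : ℝ} (hs : s ∈ Set.Ioo (0 : ℝ) 1) :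
    s ≤ (μ ⊗ₘ κ).real {z | condCDF κ V z.1 (V z) ≤ s} := by
  have hm : MeasurableSet {z : E × ℝ | condCDF κ V z.1 (V z) ≤ s} :=
    measurableSet_le (measurable_transform hV) measurable_const
  rw [measureReal_def, ← ENNReal.ofReal_le_iff_le_toReal (measure_ne_top _ _),
    Measure.compProd_apply hm]
  calc ENNReal.ofReal s = ∫⁻ _, ENNReal.ofReal s ∂μ := by simp
    _ ≤ _ := by
        refine lintegral_mono_ae ?_
        filter_upwards [hD] with x hx
        rw [ENNReal.ofReal_le_iff_le_toReal (measure_ne_top _ _)]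
        exact le_real_transform_le (ν := κ x) (W := fun y => V (x, y))
          (hV.comp measurable_prodMk_left) (hcont x hx) hs

end Transform

/-! ### Empirical frequencies of independent, not identically distributed variables. -/

section Frequencies

variable {Ω : Type*} [MeasurableSpace Ω] {n : ℕ} (ν : Fin (n + 1) → Measure Ω)
  [∀ i, IsProbabilityMeasure (ν i)]

lemma integral_ite_mem {m : Measure Ω} {A : Set Ω} [DecidablePred (· ∈ A)] (hA : MeasurableSet A) :
    ∫ ω, (if ω ∈ A then (1 : ℝ) else 0) ∂m = m.real A := by
  have : (fun ω => if ω ∈ A then (1 : ℝ) else 0) = A.indicator fun _ => 1 := by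
    ext ω; simp [Set.indicator_apply]
  rw [this, integral_indicator_const _ hA]
  simp

lemma sum_inv_mul_sub (a : Fin (n + 1) → ℝ) (c : ℝ) :
    ∑ i, 1 / ((n : ℝ) + 1) * (a i - c) = ∑ i, 1 / ((n : ℝ) + 1) * a i - c := by
  simp only [mul_sub, Finset.sum_sub_distrib]
  congr 1
  simp only [Finset.sum_const, Finset.card_univ, Fintype.card_fin, nsmul_eq_mul]
  push_cast
  field_simp

lemma real_lt_freq_le {A : Set Ω} [DecidablePred (· ∈ A)] (hA : MeasurableSet A) {s η : ℝ}
    (hη : 0 ≤ η) (hs : ∀ i, (ν i).real A ≤ s) :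
    (Measure.pi ν).real {z | s + η < ∑ i, 1 / ((n : ℝ) + 1) * (if z i ∈ A then 1 else 0)} ≤
      Real.exp (-(2 * η ^ 2 * ((n : ℝ) + 1))) := by
  have hn : (0 : ℝ) < (n : ℝ) + 1 := by positivity
  refine le_trans (measureReal_mono ?_ (measure_ne_top _ _)) (real_weighted_sum_ge_le ν
    (f := fun _ ω => if ω ∈ A then 1 else 0) (w := fun _ => 1 / ((n : ℝ) + 1))
    (fun i => Measurable.ite hA measurable_const measurable_const)
    (fun i ω => by split_ifs <;> norm_num) (fun i => by positivity)
    (by simp; field_simp) hn (fun i => le_rfl) hη)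
  intro z hz
  simp only [Set.mem_ofPred_eq] at hz ⊢
  simp only [integral_ite_mem hA]
  have : ∑ i, 1 / ((n : ℝ) + 1) * ((if z i ∈ A then 1 else 0) - s) ≤
      ∑ i, 1 / ((n : ℝ) + 1) * ((if z i ∈ A then 1 else 0) - (ν i).real A) :=
    Finset.sum_le_sum fun i _ => mul_le_mul_of_nonneg_left (by linarith [hs i]) (by positivity)
  rw [sum_inv_mul_sub] at this
  linarith

lemma real_freq_lt_le {A : Set Ω} [DecidablePred (· ∈ A)] (hA : MeasurableSet A) {s η : ℝ}
    (hη : 0 ≤ η) (hs : ∀ i, s ≤ (ν i).real A) :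
    (Measure.pi ν).real {z | ∑ i, 1 / ((n : ℝ) + 1) * (if z i ∈ A then 1 else 0) < s - η} ≤
      Real.exp (-(2 * η ^ 2 * ((n : ℝ) + 1))) := by
  have hn : (0 : ℝ) < (n : ℝ) + 1 := by positivity
  refine le_trans (measureReal_mono ?_ (measure_ne_top _ _)) (real_weighted_sum_le_le ν
    (f := fun _ ω => if ω ∈ A then 1 else 0) (w := fun _ => 1 / ((n : ℝ) + 1))
    (fun i => Measurable.ite hA measurable_const measurable_const)
    (fun i ω => by split_ifs <;> norm_num) (fun i => by positivity)
    (by simp; field_simp) hn (fun i => le_rfl) hη)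
  intro z hz
  simp only [Set.mem_ofPred_eq] at hz ⊢
  simp only [integral_ite_mem hA]
  have : ∑ i, 1 / ((n : ℝ) + 1) * ((if z i ∈ A then 1 else 0) - (ν i).real A) ≤
      ∑ i, 1 / ((n : ℝ) + 1) * ((if z i ∈ A then 1 else 0) - s) :=
    Finset.sum_le_sum fun i _ => mul_le_mul_of_nonneg_left (by linarith [hs i]) (by positivity)
  rw [sum_inv_mul_sub] at this
  linarith

end Frequencies

/-! ### Probabilities of the exceptional events. -/

section BadEvents

variable {E : Type*} [MeasurableSpace E] {n : ℕ} (μ : Fin (n + 1) → Measure E)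
  [∀ i, IsProbabilityMeasure (μ i)] {κ : Kernel E ℝ} [IsMarkovKernel κ] {V : E × ℝ → ℝ} {D : Set E}

lemma pi_real_exists_rowSum_lt_le {H : E → E → ℝ} (hH : Measurable (Function.uncurry H))
    (hH0 : ∀ x y, 0 ≤ H x y) (hD : ∀ i, ∀ᵐ x ∂μ i, x ∈ D) {q : ℝ} (hq0 : 0 ≤ q)
    (hq : ∀ x ∈ D, ∀ k, k ≠ Fin.last n → q ≤ (μ k).real {y | Real.exp (-1) ≤ H x y}) (T : ℝ) :
    (Measure.pi fun k => μ k ⊗ₘ κ).real {z | ∃ i, ∑ k, H (z i).1 (z k).1 < T} ≤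
      ((n : ℝ) + 1) * Real.exp (T - rowRate * q * ((n : ℝ) - 1)) := by
  have hset : {z : Fin (n + 1) → E × ℝ | ∃ i, ∑ k, H (z i).1 (z k).1 < T} =
      ⋃ i ∈ (Finset.univ : Finset (Fin (n + 1))), (fun (z : Fin (n + 1) → E × ℝ) i => (z i).1) ⁻¹'
        {X | ∑ k, H (X i) (X k) < T} := by
    ext z; simp
  rw [hset]
  refine (measureReal_biUnion_finset_le _ _).trans ?_
  calc _ ≤ ∑ _i : Fin (n + 1), Real.exp (T - rowRate * q * ((n : ℝ) - 1)) := by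
        refine Finset.sum_le_sum fun i _ => ?_
        rw [(measurePreserving_covariates μ).measureReal_preimage
          (measurableSet_lt (measurable_rowSum hH i) measurable_const).nullMeasurableSet]
        exact real_rowSum_lt_le μ hH hH0 (hD i) hq0 hq T
    _ = _ := by simp

lemma measurable_weightedCDF {H : E → E → ℝ} (hH : Measurable (Function.uncurry H))
    (hV : Measurable V) (i : Fin (n + 1)) (t : ℝ) :
    Measurable fun z : Fin (n + 1) → E × ℝ =>
      weightedCDF H (fun j => (z j).1) i (fun j => V (z j)) t := by
  unfold weightedCDF weight
  refine Finset.measurable_sum _ fun j _ => Measurable.mul (Measurable.div ?_ ?_) ?_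
  · exact hH.comp (f := fun z : Fin (n + 1) → E × ℝ => ((z i).1, (z j).1)) (by fun_prop)
  · exact (measurable_rowSum hH i).comp
      (f := fun z : Fin (n + 1) → E × ℝ => fun j => (z j).1) (by fun_prop)
  · exact Measurable.ite (measurableSet_le (hV.comp (measurable_pi_apply j)) measurable_const)
      measurable_const measurable_const

/-- The row-sum condition depends on the covariates alone. Over each covariate vector, either it
fails and the section is empty, or the conditional estimate applies. Fluctuation, bias and grid
error each take at most `η / 4`. -/
lemma pi_real_exists_lt_abs_sub_le (hV : Measurable V)
    {d : E → E → ℝ≥0∞} (hd : Measurable (Function.uncurry d)) {h : ℝ} (hh : 0 < h)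
    (hcont : ∀ x ∈ D, ∀ v : ℝ, κ x {y | V (x, y) = v} = 0) (hD : ∀ i, ∀ᵐ x ∂μ i, x ∈ D)
    {L : ℝ} (hL : 0 ≤ L)
    (hLip : ∀ x ∈ D, ∀ x' ∈ D, ∀ v : ℝ,
      ENNReal.ofReal |condCDF κ V x v - condCDF κ V x' v| ≤ ENNReal.ofReal L * d x x')
    {T r η : ℝ} (hT : 0 < T) (hr : 0 ≤ r) (hη : 0 ≤ η) {K : ℕ} (hK : 0 < K)
    (hKη : 2 / K ≤ η / 4) (hb : L * r + ((n : ℝ) + 1) * (Real.exp (-r / h) / T) ≤ η / 4) :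
    (Measure.pi fun k => μ k ⊗ₘ κ).real {z | (∀ i, T ≤ ∑ k, localizer d h (z i).1 (z k).1) ∧
        ∃ i, ∃ t : ℚ, η < |weightedCDF (localizer d h) (fun j => (z j).1) i (fun j => V (z j)) t -
          condCDF κ V (z i).1 t|} ≤
      ((n : ℝ) + 1) * (K * (2 * Real.exp (-(2 * (η / 4) ^ 2 * T)))) := by
  have hH := measurable_localizer (h := h) hd
  have hmeas : MeasurableSet {z : Fin (n + 1) → E × ℝ |
      (∀ i, T ≤ ∑ k, localizer d h (z i).1 (z k).1) ∧
        ∃ i, ∃ t : ℚ, η < |weightedCDF (localizer d h) (fun j => (z j).1) i (fun j => V (z j)) t -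
          condCDF κ V (z i).1 t|} := by
    refine MeasurableSet.inter ?_ ?_
    · refine MeasurableSet.congr (s := ⋂ i, {z : Fin (n + 1) → E × ℝ |
        T ≤ ∑ k, localizer d h (z i).1 (z k).1}) (MeasurableSet.iInter fun i =>
          measurableSet_le measurable_const ((measurable_rowSum hH i).comp
            (f := fun z : Fin (n + 1) → E × ℝ => fun j => (z j).1) (by fun_prop))) ?_
      ext z; simp; rfl
    · refine MeasurableSet.congr (s := ⋃ i, ⋃ t : ℚ, {z : Fin (n + 1) → E × ℝ |
        η < |weightedCDF (localizer d h) (fun j => (z j).1) i (fun j => V (z j)) t -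
          condCDF κ V (z i).1 t|}) (MeasurableSet.iUnion fun i => MeasurableSet.iUnion fun t =>
          measurableSet_lt measurable_const (Measurable.abs ((measurable_weightedCDF hH hV i t).sub
            ((measurable_condCDF hV).comp
              (f := fun z : Fin (n + 1) → E × ℝ => ((z i).1, (t : ℝ))) (by fun_prop))))) ?_
      ext z; simp; rfl
  refine ENNReal.toReal_le_of_le_ofReal (by positivity) (pi_compProd_le μ κ hmeas ?_)
  have hDall : ∀ᵐ x ∂Measure.pi μ, ∀ i, x i ∈ D :=
    ae_all_iff.2 fun i => (Measure.quasiMeasurePreserving_eval μ i).ae (hD i)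
  filter_upwards [hDall] with x hx
  by_cases hrow : ∀ i, T ≤ ∑ k, localizer d h (x i) (x k)
  · have key := pi_real_exists_lt_abs_weightedCDF_sub_le (κ := κ) hV (localizer_nonneg d h)
      (localizer_le_one hh) (X := x) (fun j => hcont _ (hx j)) hT hrow (b := η / 4)
      (fun i t => (abs_sum_weight_mul_sub_le hh hT (hrow i) (φ := fun j => condCDF κ V (x j) t)
        (fun j => condCDF_nonneg _ _) (fun j => condCDF_le_one _ _) hL
        (fun j => hLip _ (hx i) _ (hx j) t) hr).trans hb) (ε := η / 4) (by positivity) hK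
    rw [← ENNReal.ofReal_le_ofReal_iff (by positivity), ofReal_measureReal] at key
    refine le_trans (measure_mono ?_) key
    rintro y ⟨-, i, t, hit⟩
    refine ⟨i, t, lt_of_le_of_lt ?_ hit⟩
    linarith
  · refine le_trans (le_of_eq ?_) zero_le
    convert measure_empty (μ := Measure.pi fun i => κ (x i))
    ext y
    simp only [Set.mem_empty_iff_false, iff_false]
    exact fun hy => hrow hy.1

end BadEvents

/-! ### Probability that a sample is not regular. -/

section RegularProbability

variable {E : Type*} [MeasurableSpace E] {κ : Kernel E ℝ} [IsMarkovKernel κ] {V : E × ℝ → ℝ}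
  {D : Set E} {d : E → E → ℝ≥0∞} {L α η : ℝ}

/-- The data `z` form a regular sample with respect to the conditional distribution functions of
the scores. -/
def RegularData {n : ℕ} (κ : Kernel E ℝ) (V : E × ℝ → ℝ) (d : E → E → ℝ≥0∞) (h α η : ℝ)
    (z : Fin (n + 1) → E × ℝ) : Prop :=
  RegularSample (localizer d h) (fun i => (z i).1) (fun i => V (z i))
    (fun i => condCDF κ V (z i).1) α η

lemma pi_real_not_regularData_le {n : ℕ} (μ : Fin (n + 1) → Measure E)
    [∀ i, IsProbabilityMeasure (μ i)] (hV : Measurable V)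
    (hd : Measurable (Function.uncurry d)) {h : ℝ} (hh : 0 < h)
    (hcont : ∀ x ∈ D, ∀ v : ℝ, κ x {y | V (x, y) = v} = 0) (hD : ∀ i, ∀ᵐ x ∂μ i, x ∈ D)
    (hL : 0 ≤ L)
    (hLip : ∀ x ∈ D, ∀ x' ∈ D, ∀ v : ℝ,
      ENNReal.ofReal |condCDF κ V x v - condCDF κ V x' v| ≤ ENNReal.ofReal L * d x x')
    {q : ℝ} (hq0 : 0 ≤ q)
    (hq : ∀ x ∈ D, ∀ k, k ≠ Fin.last n → q ≤ (μ k).real {y | Real.exp (-1) ≤ localizer d h x y})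
    {T r : ℝ} (hT : 0 < T) (hTη : 1 / T ≤ η) (hr : 0 ≤ r) {K : ℕ} (hK : 0 < K)
    (hKη : 2 / K ≤ η / 4) (hb : L * r + ((n : ℝ) + 1) * (Real.exp (-r / h) / T) ≤ η / 4)
    (hn : 1 / ((n : ℝ) + 1) ≤ η) (hα0 : 0 < α - 3 * η) (hα1 : α + 3 * η < 1) :
    (Measure.pi fun k => μ k ⊗ₘ κ).real {z | ¬ RegularData κ V d h α η z} ≤
      ((n : ℝ) + 1) * Real.exp (T - rowRate * q * ((n : ℝ) - 1)) +
      ((n : ℝ) + 1) * (K * (2 * Real.exp (-(2 * (η / 4) ^ 2 * T)))) +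
      (Real.exp (-(2 * η ^ 2 * ((n : ℝ) + 1))) + Real.exp (-(2 * η ^ 2 * ((n : ℝ) + 1)))) := by
  classical
  have hη : 0 < η := lt_of_lt_of_le (by positivity) hn
  -- Irregularity is covered by a null event, small row sums, poor weighted distribution functions,
  -- and two atypical frequencies.
  let N : Set (Fin (n + 1) → E × ℝ) := {z | ¬ ∀ i, (z i).1 ∈ D}
  let B₁ : Set (Fin (n + 1) → E × ℝ) := {z | ∃ i, ∑ k, localizer d h (z i).1 (z k).1 < T}
  let B₂ : Set (Fin (n + 1) → E × ℝ) := {z | (∀ i, T ≤ ∑ k, localizer d h (z i).1 (z k).1) ∧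
    ∃ i, ∃ t : ℚ, η < |weightedCDF (localizer d h) (fun j => (z j).1) i (fun j => V (z j)) t -
      condCDF κ V (z i).1 t|}
  let A₁ : Set (E × ℝ) := {z | condCDF κ V z.1 (V z) < α - 3 * η}
  let A₂ : Set (E × ℝ) := {z | condCDF κ V z.1 (V z) ≤ α + 3 * η}
  let B₃ : Set (Fin (n + 1) → E × ℝ) :=
    {z | (α - 3 * η) + η < ∑ i, 1 / ((n : ℝ) + 1) * (if z i ∈ A₁ then 1 else 0)}
  let B₄ : Set (Fin (n + 1) → E × ℝ) :=
    {z | ∑ i, 1 / ((n : ℝ) + 1) * (if z i ∈ A₂ then 1 else 0) < (α + 3 * η) - η}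
  have hA₁ : MeasurableSet A₁ := measurableSet_lt (measurable_transform hV) measurable_const
  have hA₂ : MeasurableSet A₂ := measurableSet_le (measurable_transform hV) measurable_const
  have hN : (Measure.pi fun k => μ k ⊗ₘ κ).real N = 0 := by
    have : ∀ᵐ z ∂(Measure.pi fun k => μ k ⊗ₘ κ), ∀ i, (z i).1 ∈ D := by
      refine ae_all_iff.2 fun i => ?_
      have h1 : ∀ᵐ w ∂(μ i ⊗ₘ κ), w.1 ∈ D := by
        have h2 := hD i
        rw [← Measure.fst_compProd (μ i) κ] at h2
        exact ae_of_ae_map measurable_fst.aemeasurable h2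
      exact (Measure.quasiMeasurePreserving_eval (fun k => μ k ⊗ₘ κ) i).ae h1
    rw [measureReal_def, ae_iff.1 this, ENNReal.toReal_zero]
  have hB₁ := pi_real_exists_rowSum_lt_le (κ := κ) μ (measurable_localizer (h := h) hd)
    (localizer_nonneg d h) hD hq0 hq T
  have hB₂ := pi_real_exists_lt_abs_sub_le (κ := κ) μ hV hd hh hcont hD hL hLip hT hr hη.le hK
    hKη hb
  have hB₃ := real_lt_freq_le (fun k => μ k ⊗ₘ κ) hA₁ hη.le
    fun i => compProd_real_transform_lt_le hV hcont (hD i) ⟨hα0, by linarith⟩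
  have hB₄ := real_freq_lt_le (fun k => μ k ⊗ₘ κ) hA₂ hη.le
    fun i => le_compProd_real_transform_le hV hcont (hD i) ⟨by linarith, hα1⟩
  have hsub : {z | ¬ RegularData κ V d h α η z} ⊆ N ∪ (B₁ ∪ B₂ ∪ (B₃ ∪ B₄)) := by
    intro z hz
    by_contra hc
    simp only [Set.mem_union, not_or] at hc
    obtain ⟨c0, ⟨c1, c2⟩, c3, c4⟩ := hc
    simp only [N, B₁, B₂, B₃, B₄, A₁, A₂, Set.mem_ofPred_eq, not_not, not_exists, not_lt,
      not_and] at c0 c1 c2 c3 c4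
    have hc : ∀ i, Continuous (condCDF κ V (z i).1) := fun i =>
      continuous_condCDF hV (hcont _ (c0 i))
    refine hz ⟨localizer_nonneg d h, fun i => hT.trans_le (c1 i), fun i j =>
      (weight_le_div hT (c1 i) zero_le_one (localizer_le_one hh _ _)).trans hTη,
      fun i => monotone_condCDF _, hc, fun i =>
      abs_sub_le_of_forall_rat (monotone_weightedCDF (localizer_nonneg d h) _ i _) (hc i)
        (c2 c1 i), hn, ?_, ?_⟩
    · refine le_trans (le_of_eq ?_) (c3.trans (by linarith))
      congr!
    · refine le_trans (by linarith) (c4.trans (le_of_eq ?_))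
      congr!
  calc _ ≤ _ := measureReal_mono hsub (measure_ne_top _ _)
    _ ≤ _ := measureReal_union_le _ _
    _ ≤ 0 + _ := add_le_add hN.le ((measureReal_union_le _ _).trans
        (add_le_add ((measureReal_union_le _ _).trans (add_le_add hB₁ hB₂))
          ((measureReal_union_le _ _).trans (add_le_add hB₃ hB₄))))
    _ = _ := zero_add _

end RegularProbability

/-! ### Regularity with probability tending to one. -/

section Asymptotics

/-- Eventually `a * T n ≥ 2 * log n`, so the exponential is at most `n ^ (-2)` and absorbs the union
bound over rows. -/
lemma tendsto_mul_exp_neg {T : ℕ → ℝ} (hT : Tendsto (fun n : ℕ => T n / Real.log n) atTop atTop)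
    {a : ℝ} (ha : 0 < a) :
    Tendsto (fun n : ℕ => ((n : ℝ) + 1) * Real.exp (-(a * T n))) atTop (𝓝 0) := by
  have h2 : Tendsto (fun n : ℕ => (2 : ℝ) / n) atTop (𝓝 0) :=
    tendsto_const_div_atTop_nhds_zero_nat 2
  refine squeeze_zero' (Eventually.of_forall fun n => by positivity) ?_ h2
  filter_upwards [hT.eventually_ge_atTop (2 / a), eventually_ge_atTop 2] with n hn hn2
  have hn2' : (2 : ℝ) ≤ n := by exact_mod_cast hn2
  have hlog : 0 < Real.log n := Real.log_pos (by linarith)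
  rw [div_le_div_iff₀ ha hlog] at hn
  have h3 : Real.exp (-(a * T n)) ≤ 1 / (n : ℝ) ^ 2 := by
    calc Real.exp (-(a * T n)) ≤ Real.exp (-(2 * Real.log n)) := by
          rw [Real.exp_le_exp]; linarith
      _ = 1 / (n : ℝ) ^ 2 := by
          rw [Real.exp_neg, two_mul, Real.exp_add, Real.exp_log (by linarith), one_div, sq]
  calc ((n : ℝ) + 1) * Real.exp (-(a * T n)) ≤ (2 * n) * (1 / (n : ℝ) ^ 2) := by
        gcongr; linarith
    _ = 2 / n := by field_simp

lemma tendsto_atTop_of_div_log {T : ℕ → ℝ}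
    (hT : Tendsto (fun n : ℕ => T n / Real.log n) atTop atTop) : Tendsto T atTop atTop := by
  have h1 := hT.atTop_mul_atTop₀ (Real.tendsto_log_atTop.comp tendsto_natCast_atTop_atTop)
  refine h1.congr' ?_
  filter_upwards [eventually_ge_atTop 2] with n hn
  have hn2' : (2 : ℝ) ≤ n := by exact_mod_cast hn
  have hlog : 0 < Real.log n := Real.log_pos (by linarith)
  simp only [Function.comp]
  field_simp

lemma tendsto_exp_neg_div_mul_rpow {h : ℕ → ℝ} (hpos : ∀ᶠ n in atTop, 0 < h n)
    (hh0 : Tendsto h atTop (𝓝 0)) (β : ℝ) {r : ℝ} (hr : 0 < r) :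
    Tendsto (fun n => Real.exp (-r / h n) / h n ^ β) atTop (𝓝 0) := by
  have h1 : Tendsto (fun n => (h n)⁻¹) atTop atTop :=
    tendsto_inv_nhdsGT_zero.comp (tendsto_nhdsWithin_iff.2 ⟨hh0, hpos⟩)
  refine ((tendsto_rpow_mul_exp_neg_mul_atTop_nhds_zero β r hr).comp h1).congr' ?_
  filter_upwards [hpos] with n hn
  simp only [Function.comp]
  rw [Real.inv_rpow hn.le, div_eq_mul_inv, div_eq_mul_inv, mul_comm]

variable {E : Type*} [MeasurableSpace E] {κ : Kernel E ℝ} [IsMarkovKernel κ] {V : E × ℝ → ℝ}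
  {D : Set E} {d : E → E → ℝ≥0∞} {L β α η : ℝ}

lemma tendsto_real_not_regularData {μ : (n : ℕ) → Fin (n + 1) → Measure E}
    [∀ n i, IsProbabilityMeasure (μ n i)] (hV : Measurable V)
    (hd : Measurable (Function.uncurry d)) {h : ℕ → ℝ} (hpos : ∀ n, 1 ≤ n → 0 < h n)
    (hcont : ∀ x ∈ D, ∀ v : ℝ, κ x {y | V (x, y) = v} = 0) (hD : ∀ n i, ∀ᵐ x ∂μ n i, x ∈ D)
    (hL : 0 < L)
    (hLip : ∀ x ∈ D, ∀ x' ∈ D, ∀ v : ℝ,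
      ENNReal.ofReal |condCDF κ V x v - condCDF κ V x' v| ≤ ENNReal.ofReal L * d x x')
    (hball : ∀ n, 1 ≤ n → ∀ x ∈ D, ∀ k, k ≠ Fin.last n →
      h n ^ β / L ≤ (μ n k).real {y | d x y ≤ ENNReal.ofReal (h n)})
    (hh0 : Tendsto h atTop (𝓝 0))
    (hhn : Tendsto (fun n : ℕ => (n : ℝ) * h n ^ β / Real.log n) atTop atTop)
    (hη : 0 < η) (hα0 : 0 < α - 3 * η) (hα1 : α + 3 * η < 1) :
    Tendsto (fun n => (Measure.pi fun k => μ n k ⊗ₘ κ).real {z | ¬ RegularData κ V d (h n) α η z})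
      atTop (𝓝 0) := by
  have hρ := rowRate_pos
  -- With this `c` the Chernoff exponent is `4 * c * h n ^ β * (n - 1)`, at least `2 * T n` for `n ≥
  -- 2`, which leaves a net decay `exp (-T n)`.
  set c : ℝ := rowRate / (4 * L) with hc
  have hc0 : 0 < c := by positivity
  let T : ℕ → ℝ := fun n => c * (n * h n ^ β)
  have hTlog : Tendsto (fun n : ℕ => T n / Real.log n) atTop atTop := by
    refine (hhn.const_mul_atTop hc0).congr fun n => ?_
    simp only [T]
    ring
  have hTtop := tendsto_atTop_of_div_log hTlog
  have hhpos : ∀ᶠ n in atTop, 0 < h n := by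
    filter_upwards [eventually_ge_atTop 1] with n hn using hpos n hn
  obtain ⟨K, hK⟩ := exists_nat_gt (8 / η)
  have hK' : (0 : ℝ) < K := lt_trans (by positivity) hK
  have hK0 : 0 < K := by exact_mod_cast hK'
  have hKη : 2 / (K : ℝ) ≤ η / 4 := by
    rw [div_lt_iff₀ hη] at hK
    rw [div_le_iff₀ hK']
    linarith
  -- The Lipschitz part of the bias is then exactly `η / 8`; the far part must fit in the other `η /
  -- 8`.
  set r : ℝ := η / (8 * L) with hr
  have hr0 : 0 < r := by positivity
  have hbias : ∀ᶠ n : ℕ in atTop,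
      L * r + ((n : ℝ) + 1) * (Real.exp (-r / h n) / T n) ≤ η / 4 := by
    have h1 := (tendsto_exp_neg_div_mul_rpow hhpos hh0 β hr0).const_mul (2 / c)
    rw [mul_zero] at h1
    filter_upwards [h1.eventually_le_const (show 0 < η / 8 by positivity), hhpos,
      eventually_ge_atTop 1] with n h2 hn hn1
    have hn1' : (1 : ℝ) ≤ n := by exact_mod_cast hn1
    have hβ : 0 < h n ^ β := Real.rpow_pos_of_pos hn β
    have h3 : ((n : ℝ) + 1) * (Real.exp (-r / h n) / T n) ≤
        2 / c * (Real.exp (-r / h n) / h n ^ β) := by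
      calc ((n : ℝ) + 1) * (Real.exp (-r / h n) / T n)
          ≤ (2 * n) * (Real.exp (-r / h n) / T n) := by
            have : 0 ≤ T n := by positivity
            gcongr
            linarith
        _ = _ := by simp only [T]; field_simp
    have h4 : L * r = η / 8 := by rw [hr]; field_simp
    linarith
  have hlim : Tendsto (fun n : ℕ => ((n : ℝ) + 1) * Real.exp (-(1 * T n)) +
      2 * K * (((n : ℝ) + 1) * Real.exp (-((2 * (η / 4) ^ 2) * T n))) +
      2 * Real.exp (-(2 * η ^ 2 * ((n : ℝ) + 1)))) atTop (𝓝 0) := by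
    have e1 := tendsto_mul_exp_neg hTlog one_pos
    have e2 := (tendsto_mul_exp_neg hTlog (show 0 < 2 * (η / 4) ^ 2 by positivity)).const_mul
      (2 * (K : ℝ))
    have e3 : Tendsto (fun n : ℕ => 2 * Real.exp (-(2 * η ^ 2 * ((n : ℝ) + 1)))) atTop
        (𝓝 (2 * 0)) :=
      (Real.tendsto_exp_neg_atTop_nhds_zero.comp ((tendsto_natCast_atTop_atTop.atTop_add
        tendsto_const_nhds).const_mul_atTop (show 0 < 2 * η ^ 2 by positivity))).const_mul 2
    simpa using (e1.add e2).add e3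
  refine squeeze_zero' (Eventually.of_forall fun n => measureReal_nonneg) ?_ hlim
  filter_upwards [hbias, eventually_ge_atTop 2, hTtop.eventually_ge_atTop (1 / η),
    tendsto_one_div_add_atTop_nhds_zero_nat.eventually_le_const hη] with n hb hn2 hTn hninv
  have hn : 0 < h n := hpos n (by omega)
  have hn2' : (2 : ℝ) ≤ n := by exact_mod_cast hn2
  have hβ : 0 < h n ^ β := Real.rpow_pos_of_pos hn β
  have hT0 : 0 < T n := by positivity
  refine (pi_real_not_regularData_le (μ n) hV hd hn hcont (hD n) hL.le hLip
    (q := h n ^ β / L) (by positivity) (fun x hx k hk => (hball n (by omega) x hx k hk).trans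
      (measureReal_mono fun y hy => exp_neg_one_le_localizer hn hy)) hT0
    ((div_le_comm₀ hT0 hη).2 hTn) hr0.le hK0 hKη hb hninv hα0 hα1).trans ?_
  have hexp : T n - rowRate * (h n ^ β / L) * ((n : ℝ) - 1) ≤ -(1 * T n) := by
    have : rowRate * (h n ^ β / L) * ((n : ℝ) - 1) = 4 * c * h n ^ β * (n - 1) := by
      rw [hc]; field_simp
    rw [this]
    simp only [T]
    have : 0 ≤ c * h n ^ β * (n - 2) := by
      have : (0 : ℝ) ≤ n - 2 := by linarith
      positivity
    linarith
  have h1 := mul_le_mul_of_nonneg_left (Real.exp_le_exp.2 hexp)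
    (show (0 : ℝ) ≤ (n : ℝ) + 1 by positivity)
  linarith

end Asymptotics

/-! ### Limits of probabilities from regularity. -/

lemma exists_tolerance {α ε : ℝ} (hα : α ∈ Set.Ioo (0 : ℝ) 1) (hε : 0 < ε) :
    ∃ η : ℝ, 0 < η ∧ 0 < α - 10 * η ∧ α + 10 * η < 1 ∧ 20 * η < ε := by
  obtain ⟨hα0, hα1⟩ := hα
  refine ⟨min (ε / 21) (min (α / 11) ((1 - α) / 11)), ?_, ?_, ?_, ?_⟩
  · have : 0 < 1 - α := by linarith
    positivity
  · have := (min_le_right (ε / 21) (min (α / 11) ((1 - α) / 11))).trans (min_le_left _ _)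
    linarith
  · have := (min_le_right (ε / 21) (min (α / 11) ((1 - α) / 11))).trans (min_le_right _ _)
    linarith
  · have := min_le_left (ε / 21) (min (α / 11) ((1 - α) / 11))
    linarith

/-- Subadditivity replaces taking complements, so neither event has to be measurable. -/
lemma tendsto_real_one_of_not_subset {Ω : ℕ → Type*} [∀ n, MeasurableSpace (Ω n)]
    {Q : (n : ℕ) → Measure (Ω n)} [∀ n, IsProbabilityMeasure (Q n)] {B A : (n : ℕ) → Set (Ω n)}
    (hB : Tendsto (fun n => (Q n).real (B n)) atTop (𝓝 0)) (hAB : ∀ n z, z ∉ B n → z ∈ A n) :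
    Tendsto (fun n => (Q n).real (A n)) atTop (𝓝 1) := by
  have h1 : Tendsto (fun n => 1 - (Q n).real (B n)) atTop (𝓝 1) := by
    simpa using hB.const_sub 1
  refine tendsto_of_tendsto_of_tendsto_of_le_of_le h1 tendsto_const_nhds (fun n => ?_)
    fun n => measureReal_le_one
  have h2 : (Q n).real Set.univ ≤ (Q n).real (A n ∪ B n) :=
    measureReal_mono fun z _ => or_iff_not_imp_right.2 (hAB n z)
  have h3 := measureReal_union_le (μ := Q n) (A n) (B n)
  rw [probReal_univ] at h2
  simp only
  linarith

variable {E : Type*} [MeasurableSpace E] {κ : Kernel E ℝ} [IsMarkovKernel κ] {V : E × ℝ → ℝ}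
  {D : Set E} {d : E → E → ℝ≥0∞} {α : ℝ}

/-- An event that, on regular data, is determined up to a small error by the transformed last
score being at most `α`, has asymptotic probability `α`. -/
lemma tendsto_real_of_regularData {μ : (n : ℕ) → Fin (n + 1) → Measure E}
    [∀ n i, IsProbabilityMeasure (μ n i)] (hV : Measurable V) {h : ℕ → ℝ}
    (hcont : ∀ x ∈ D, ∀ v : ℝ, κ x {y | V (x, y) = v} = 0) (hD : ∀ n i, ∀ᵐ x ∂μ n i, x ∈ D)
    (hα : α ∈ Set.Ioo (0 : ℝ) 1)
    (hreg : ∀ η : ℝ, 0 < η → 0 < α - 3 * η → α + 3 * η < 1 → Tendsto (fun n =>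
      (Measure.pi fun k => μ n k ⊗ₘ κ).real {z | ¬ RegularData κ V d (h n) α η z}) atTop (𝓝 0))
    {A : (n : ℕ) → Set (Fin (n + 1) → E × ℝ)}
    (hA : ∀ η n z, 0 < α - 10 * η → α + 10 * η < 1 → RegularData κ V d (h n) α η z →
      (condCDF κ V (z (Fin.last n)).1 (V (z (Fin.last n))) ≤ α - 10 * η → z ∈ A n) ∧
      (z ∈ A n → condCDF κ V (z (Fin.last n)).1 (V (z (Fin.last n))) < α + 10 * η)) :
    Tendsto (fun n => (Measure.pi fun k => μ n k ⊗ₘ κ).real (A n)) atTop (𝓝 α) := by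
  rw [Metric.tendsto_nhds]
  intro ε hε
  -- Since `20η < ε`, the error `10η` in the level is below `ε / 2`; irregular data take the other
  -- `ε / 2`.
  obtain ⟨η, hη, hη1, hη2, hη3⟩ := exists_tolerance hα hε
  filter_upwards [(hreg η hη (by linarith) (by linarith)).eventually_lt_const
    (show 0 < ε / 2 by positivity)] with n hn
  set Q := Measure.pi fun k => μ n k ⊗ₘ κ with hQ
  have hpre : ∀ B : Set (E × ℝ), MeasurableSet B →
      Q.real {z | z (Fin.last n) ∈ B} = (μ n (Fin.last n) ⊗ₘ κ).real B := fun B hB =>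
    (measurePreserving_eval (fun k => μ n k ⊗ₘ κ) (Fin.last n)).measureReal_preimage
      hB.nullMeasurableSet
  have h1 : α - 10 * η ≤ Q.real (A n) + Q.real {z | ¬ RegularData κ V d (h n) α η z} := by
    refine (le_compProd_real_transform_le hV hcont (hD n (Fin.last n))
      ⟨hη1, by linarith⟩).trans ?_
    rw [← hpre _ (measurableSet_le (measurable_transform hV) measurable_const)]
    refine (measureReal_mono (fun z hz => ?_) (measure_ne_top _ _)).trans
      (measureReal_union_le _ _)
    by_cases hr : RegularData κ V d (h n) α η z
    · exact Or.inl ((hA η n z hη1 hη2 hr).1 hz)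
    · exact Or.inr hr
  have h2 : Q.real (A n) ≤ α + 10 * η + Q.real {z | ¬ RegularData κ V d (h n) α η z} := by
    have h3 := compProd_real_transform_lt_le hV hcont (hD n (Fin.last n))
      (s := α + 10 * η) ⟨by linarith [hα.1], hη2⟩
    rw [← hpre _ (measurableSet_lt (measurable_transform hV) measurable_const)] at h3
    refine le_trans (measureReal_mono (fun z hz => ?_) (measure_ne_top _ _))
      ((measureReal_union_le _ _).trans (add_le_add_left h3 _))
    by_cases hr : RegularData κ V d (h n) α η z
    · exact Or.inl ((hA η n z hη1 hη2 hr).2 hz)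
    · exact Or.inr hr
  rw [Real.dist_eq, abs_lt]
  constructor <;> linarith

end LCP

theorem mainTheorem2 {p : ℕ}
    (P : Measure ((Fin p → ℝ) × ℝ)) [IsProbabilityMeasure P]
    (κ : Kernel (Fin p → ℝ) ℝ) [IsMarkovKernel κ] (hκ : P.fst ⊗ₘ κ = P)
    (V : (Fin p → ℝ) × ℝ → ℝ) (hV : Measurable V)
    (α : ℝ) (hα : α ∈ Set.Ioo (0 : ℝ) 1)
    (d : (Fin p → ℝ) → (Fin p → ℝ) → ℝ≥0∞) (hd : Measurable (Function.uncurry d))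
    (hd0 : ∀ x, d x x = 0)
    (h : ℕ → ℝ) (hpos : ∀ n, 1 ≤ n → 0 < h n)
    (L β : ℝ) (hL : 0 < L) (hβ : 0 ≤ β)
    (f : (Fin p → ℝ) → ℝ≥0∞) (hf : Measurable f)
    (hPX : P.fst = (volume.restrict (Set.Icc 0 1)).withDensity f)
    (hfL : ∀ x ∈ Set.Icc (0 : Fin p → ℝ) 1, ENNReal.ofReal (1 / L) ≤ f x)
    (hcont : ∀ x ∈ Set.Icc (0 : Fin p → ℝ) 1, ∀ v : ℝ, κ x {y | V (x, y) = v} = 0)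
    (hLip : ∀ x ∈ Set.Icc (0 : Fin p → ℝ) 1, ∀ x' ∈ Set.Icc (0 : Fin p → ℝ) 1, ∀ v : ℝ,
      ENNReal.ofReal |LCP.condCDF κ V x v - LCP.condCDF κ V x' v| ≤ ENNReal.ofReal L * d x x')
    (hball : ∀ n, 1 ≤ n → ∀ ε : ℝ, 0 < ε → ε ≤ h n → ∀ x₀ ∈ Set.Icc (0 : Fin p → ℝ) 1,
      ε ^ β / L ≤ P.fst.real {x | d x₀ x ≤ ENNReal.ofReal ε})
    (hh0 : Tendsto h atTop (𝓝 0))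
    (hhn : Tendsto (fun n : ℕ => (n : ℝ) * h n ^ β / Real.log n) atTop atTop)
    (x₀ : Fin p → ℝ) (hx₀ : x₀ ∈ Set.Icc (0 : Fin p → ℝ) 1) :
    Tendsto (fun n : ℕ => (LCP.condLaw P κ n x₀).real
        {z | V (z (Fin.last n)) ∈
          LCP.predSet (LCP.localizer d (h n)) (fun i => (z i).1) (fun i => V (z i)) α})
      atTop (𝓝 α) ∧
    Tendsto (fun n : ℕ => (LCP.condLaw P κ n x₀).real
        {z | (V (z (Fin.last n)) : EReal) ≤ LCP.quantile α
          (LCP.testLaw (LCP.localizer d (h n)) (fun i => (z i).1) (fun i => V (z i)))})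
      atTop (𝓝 α) ∧
    ∀ ε : ℝ, 0 < ε →
      Tendsto (fun n : ℕ => (LCP.condLaw P κ n x₀).real
          {z | (⨆ v : ℝ, |LCP.alphaTilde (LCP.localizer d (h n))
            (fun i => (z i).1) (fun i => V (z i)) α v - α|) < ε})
        atTop (𝓝 1) := by
  set D : Set (Fin p → ℝ) := Set.Icc 0 1 with hDdef
  have hDm : MeasurableSet D := measurableSet_Icc
  have hPD : ∀ᵐ x ∂P.fst, x ∈ D := by
    rw [hPX]
    exact (withDensity_absolutelyContinuous _ _).ae_le (ae_restrict_mem hDm)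
  have hD : ∀ n (i : Fin (n + 1)), ∀ᵐ x ∂LCP.covLaw P n x₀ i, x ∈ D := fun n i =>
    LCP.ae_covLaw_mem hDm hPD hx₀ i
  have hballs : ∀ n, 1 ≤ n → ∀ x ∈ D, ∀ k, k ≠ Fin.last n →
      h n ^ β / L ≤ (LCP.covLaw P n x₀ k).real {y | d x y ≤ ENNReal.ofReal (h n)} := by
    intro n hn x hx k hk
    rw [LCP.covLaw, if_neg hk]
    exact hball n hn (h n) (hpos n hn) le_rfl x hx
  have hreg : ∀ η : ℝ, 0 < η → 0 < α - 3 * η → α + 3 * η < 1 → Tendsto (fun n =>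
      (Measure.pi fun k => LCP.covLaw P n x₀ k ⊗ₘ κ).real
        {z | ¬ LCP.RegularData κ V d (h n) α η z}) atTop (𝓝 0) := fun η hη h1 h2 =>
    LCP.tendsto_real_not_regularData hV hd hpos hcont hD hL hLip hballs hh0 hhn hη h1 h2
  simp_rw [LCP.condLaw_eq_pi_compProd hκ]
  obtain ⟨hα0, hα1⟩ := hα
  refine ⟨?_, ?_, ?_⟩
  · refine LCP.tendsto_real_of_regularData hV hcont hD ⟨hα0, hα1⟩ hreg
      fun η n z _ h2 hz => ?_
    -- The bound on `alphaTilde` holds for every `v`, so it may be used at the random value `v =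
    -- V_{n+1}`.
    have ha := abs_le.1 (hz.abs_alphaTilde_sub_le hα0.le (by linarith [hz.pos])
      (V (z (Fin.last n))))
    exact ⟨fun hu => hz.le_quantile_testLaw (by linarith) hu,
      fun hu => hz.lt_of_le_quantile_testLaw (by linarith) hu⟩
  -- The fixed level `α` lies trivially in the window `α ± 7η`, so the same squeeze applies.
  · refine LCP.tendsto_real_of_regularData hV hcont hD ⟨hα0, hα1⟩ hreg
      fun η n z _ h2 hz => ?_
    exact ⟨fun hu => hz.le_quantile_testLaw (by linarith [hz.pos]) hu,
      fun hu => hz.lt_of_le_quantile_testLaw (by linarith [hz.pos]) hu⟩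
  · intro ε hε
    obtain ⟨η, hη, hη1, hη2, hη3⟩ := LCP.exists_tolerance ⟨hα0, hα1⟩ hε
    refine LCP.tendsto_real_one_of_not_subset (hreg η hη (by linarith) (by linarith))
      fun n z hz => ?_
    have hz : LCP.RegularData κ V d (h n) α η z := not_not.1 hz
    -- The supremum is at most `7η`, and the strict inequality comes from `7η < 20η < ε`.
    refine lt_of_le_of_lt (ciSup_le fun v =>
      hz.abs_alphaTilde_sub_le hα0.le (by linarith) v) (by linarith)
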